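/- **Theorem 1.5.** All digraphs are finite and may have parallel arcs but no loops. Let $D=(V+x,A)$ be a digraph, where $V+x=V\cup\{x\}$ and $x\notin V$, let $k>0$ be an integer, let $\{I_1,\dots,I_l\}$ be a partition of $[k]=\{1,\dots,k\}$ into nonempty blocks, and let $c_1,\dots,c_l$ be nonnegative integers. An $x$-arborescence in $D$ is a (not necessarily spanning) subdigraph $F$ of $D$ containing $x$ whose underlying graph is a tree and such that for every $u\in V(F)$ there is exactly one directed path in $F$ from $x$ to $u$; it is spanning if $V(F)=V+x$. For a set $B$ of arcs and $X\subseteq V+x$, let $d^-_B(X)$ and $d^+_B(X)$ be the numbers of arcs of $B$ entering and leaving $X$, respectively, and let $[x,u]_B$ be the number of arcs of $B$ with tail $x$ and head $u$. A subdigraph used as a subscript stands for its arc set, and $d^+_B(x)=d^+_B(\{x\})$. Let $F_1,\dots,F_k$ be pairwise arc-disjoint $x$-arborescences in $D$, and let $A_0=A\setminus\bigcup_{i=1}^kF_i$ be the set of arcs of $D$ that lie in none of them. For $I\subseteq[k]$ put $\overline I=[k]\setminus I$; for $X\subseteq V$ put $P_I(X)=\{i\in I: X\cap V(F_i)=\emptyset\}$;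 and for $u\in V$ put $$w_I(u)=\min\bigl\{|\{i\in I:u\notin V(F_i)\}|,\ [x,u]_{A_0}\bigr\}$$ if $D$ has an arc from $x$ to $u$, and $w_I(u)=0$ otherwise. Then there exist pairwise arc-disjoint spanning $x$-arborescences $F^*_1,\dots,F^*_k$ in $D$ such that $F_i$ is a subdigraph of $F^*_i$ for every $i\in[k]$ and $$\sum_{i\in I_\alpha}d^+_{F^*_i}(x)\ge c_\alpha\qquad\text{for every }\alpha\in[l]$$ if and only if, for every integer $t\ge 0$, all pairwise disjoint nonempty subsets $X_1,\dots,X_t$ of $V$, and every $I\subseteq[k]$ that is the union of some (possibly none or all) of $I_1,\dots,I_l$, $$\sum_{j=1}^{t}d^-_{A_0}(X_j)\ \ge\ \sum_{j=1}^{t}|P_I(X_j)|+\sum_{\alpha:\,I_\alpha\subseteq\overline I}\Bigl(c_\alpha-\sum_{i\in I_\alpha}d^+_{F_i}(x)\Bigr)-\sum_{u\in V\setminus\bigcup_{j=1}^tX_j}w_{\overline I}(u).\tag{4}$$ -/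

import Mathlib

/-- A directed multigraph with vertex type `U` and arc type `A`: parallel arcs are allowed,
loops are not. -/
structure MultiDigraph (U A : Type*) where
  /-- The tail of an arc. -/
  tail : A → U
  /-- The head of an arc. -/
  head : A → U
  loopless : ∀ a, tail a ≠ head a

namespace MultiDigraph

variable {U A : Type*}

/-- A (not necessarily spanning) subdigraph: a set of vertices and a set of arcs all of whose
ends are among these vertices. -/
structure Subdigraph (D : MultiDigraph U A) where
  verts : Finset U
  arcs : Finset A
  tail_mem : ∀ a ∈ arcs, D.tail a ∈ verts
  head_mem : ∀ a ∈ arcs, D.head a ∈ verts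

/-- The sequence of arcs `p` is a directed walk from `u` to `v`. -/
def IsDiwalk (D : MultiDigraph U A) : U → List A → U → Prop
  | u, [], v => u = v
  | u, a :: p, v => D.tail a = u ∧ D.IsDiwalk (D.head a) p v

namespace Subdigraph

variable {D : MultiDigraph U A}

/-- The sequence of arcs `p` is a directed path from `u` to `v` in the subdigraph `F`: a directed
walk with arcs in `F` that starts at a vertex of `F` and visits no vertex twice. -/
def IsDipath (F : D.Subdigraph) (u : U) (p : List A) (v : U) : Prop :=
  u ∈ F.verts ∧ D.IsDiwalk u p v ∧ (∀ a ∈ p, a ∈ F.arcs) ∧ (u :: p.map D.head).Nodup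

/-- The simple graph that underlies `F`: forget the directions and the multiplicities. -/
def underlying (F : D.Subdigraph) : SimpleGraph {u : U // u ∈ F.verts} where
  Adj u v := ∃ a ∈ F.arcs,
    (D.tail a = u.1 ∧ D.head a = v.1) ∨ (D.tail a = v.1 ∧ D.head a = u.1)
  symm := ⟨fun _ _ ⟨a, ha, h⟩ => ⟨a, ha, h.symm⟩⟩
  loopless := ⟨fun _ ⟨a, _, h⟩ => by
    rcases h with h | h <;> exact D.loopless a (h.1.trans h.2.symm)⟩

/-- The underlying undirected multigraph of `F` is a tree: no two arcs have the same pair of ends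
(such arcs would form a cycle of length two), and after forgetting multiplicities it is a tree. -/
def UnderlyingIsTree (F : D.Subdigraph) : Prop :=
  (∀ a ∈ F.arcs, ∀ b ∈ F.arcs, s(D.tail a, D.head a) = s(D.tail b, D.head b) → a = b) ∧
    F.underlying.IsTree

/-- `F` is an `r`-arborescence: its underlying graph is a tree, and for every vertex `u` of `F`
there is exactly one directed path in `F` from `r` to `u`. -/
def IsArborescence (F : D.Subdigraph) (r : U) : Prop :=
  r ∈ F.verts ∧ F.UnderlyingIsTree ∧ ∀ u ∈ F.verts, ∃! p : List A, F.IsDipath r p u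

/-- `F` contains every vertex of the digraph. -/
def IsSpanning (F : D.Subdigraph) : Prop := ∀ u : U, u ∈ F.verts

/-- `F` is a subdigraph of `G`. -/
def IsSub (F G : D.Subdigraph) : Prop := F.verts ⊆ G.verts ∧ F.arcs ⊆ G.arcs

end Subdigraph

/-- The members of the family `F` are pairwise arc-disjoint. -/
def ArcDisjoint {D : MultiDigraph U A} {k : ℕ} (F : Fin k → D.Subdigraph) : Prop :=
  ∀ i j, i ≠ j → Disjoint (F i).arcs (F j).arcs

variable [Fintype U] [DecidableEq U]

/-- `[X, Y]_B`: the number of arcs in `B` with tail in `X` and head in `Y`. -/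
def count (D : MultiDigraph U A) (B : Finset A) (X Y : Finset U) : ℕ :=
  (B.filter fun a => D.tail a ∈ X ∧ D.head a ∈ Y).card

/-- `d⁻_B(X)`: the number of arcs in `B` entering `X`. -/
def inDeg (D : MultiDigraph U A) (B : Finset A) (X : Finset U) : ℕ :=
  D.count B Xᶜ X

/-- `d⁺_B(X)`: the number of arcs in `B` leaving `X`. -/
def outDeg (D : MultiDigraph U A) (B : Finset A) (X : Finset U) : ℕ :=
  D.count B X Xᶜ

/-- `N⁺(x)`: the set of heads of the arcs with tail `x`. -/
def outNbrs (D : MultiDigraph U A) [Fintype A] (x : U) : Finset U :=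
  (Finset.univ.filter fun a => D.tail a = x).image D.head

/-- The arcs that lie in none of `F 1, …, F k`. -/
def freeArcs {D : MultiDigraph U A} [Fintype A] [DecidableEq A] {k : ℕ}
    (F : Fin k → D.Subdigraph) : Finset A :=
  Finset.univ \ Finset.univ.biUnion fun i => (F i).arcs

/-- `P_I(X)`: the indices `i ∈ I` for which `F i` has no vertex in `X`. -/
def missing {D : MultiDigraph U A} {k : ℕ} (F : Fin k → D.Subdigraph) (I : Finset (Fin k))
    (X : Finset U) : Finset (Fin k) :=
  I.filter fun i => X ∩ (F i).verts = ∅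

/-- The weight `w_I(u)`. -/
def weight {D : MultiDigraph U A} [Fintype A] [DecidableEq A] {k : ℕ}
    (F : Fin k → D.Subdigraph) (x : U) (I : Finset (Fin k)) (u : U) : ℕ :=
  if u ∈ D.outNbrs x then
    min (I.filter fun i => u ∉ (F i).verts).card (D.count (freeArcs F) {x} {u})
  else 0

end MultiDigraph

/-! Let `K` consist of the blocks outside `I`. Rearranged, the stated inequality bounds the demand
of `K` for further root arcs by `val K X`: each set of the packing contributes the free arcs
entering it minus one for every member outside `K` that misses it, and each uncovered vertex
contributes the number of root arcs that `K` can use there. Necessity follows by counting the root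
arcs that the blocks in `K` gain, inside and outside the sets.

For sufficiency, free root arcs are handed out one by one so that all these inequalities survive
(`RootData.Feasible.exists_addRoot`). When no member can use another one, all weights vanish; the
empty packing at the level of a single block then says that its demand is met, and a single set at
the empty level gives the cut condition of Edmonds' theorem, which completes the trees
(`exists_spanning_of_cut_condition`, by Lovász's minimal tight set argument).

The heart is that some member can take a usable arc to `u`. Otherwise every member `i` missing `u`
is blocked by a tight packing at a level without its block, which either leaves `u` uncovered and
exhausts the arcs to `u`, or covers `u` by a set meeting `R i`. Tight packings at `K` and `L`
uncross to tight packings at `K ∪ L` and `K ∩ L` (`val_uncross`): sets that meet are merged and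
intersected by submodularity; a set disjoint from the other packing goes to the upper level if some
vertex in it has more free root arcs than the other level can use, and to the lower level otherwise.
Take a minimal level `K₀` that exhausts `u` (or is the set of all blocks), a maximal proper part
`K₁` of it with a tight packing covering `u`, and a maximal set `S` through `u` in such a packing.
Then `S` meets every member in the blocks of `K₀ \ K₁`, so it spares equally many arcs at both
levels, and at `K₀` at least as many as there are free root arcs into it. Deleting `S` therefore
leaves a tight packing that exhausts `u` at `K₁`, against the choice of `K₀`. -/

set_option linter.unusedSectionVars false

/-! ### Uncrossing two packings at two levels. -/

section Uncrossing

variable {U β : Type*} [DecidableEq U] [DecidableEq β]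

/-- A set function with an additional level in a set lattice: it is monotone in the level, and
submodular on intersecting pairs of sets. -/
structure LeveledSubmodular (f : Finset β → Finset U → ℤ) : Prop where
  mono : ∀ {K L : Finset β} (S : Finset U), K ⊆ L → f K S ≤ f L S
  submod : ∀ (K L : Finset β) (S T : Finset U), (S ∩ T).Nonempty →
    f (K ∪ L) (S ∪ T) + f (K ∩ L) (S ∩ T) ≤ f K S + f L T

/-- A family of pairwise disjoint nonempty sets. -/
def IsPacking (X : Finset (Finset U)) : Prop :=
  (∀ S ∈ X, S.Nonempty) ∧ ∀ S ∈ X, ∀ T ∈ X, S ≠ T → Disjoint S T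

theorem IsPacking.mono {X Y : Finset (Finset U)} (hX : IsPacking X) (h : Y ⊆ X) : IsPacking Y :=
  ⟨fun S hS => hX.1 S (h hS), fun S hS T hT => hX.2 S (h hS) T (h hT)⟩

theorem IsPacking.eq_of_mem {X : Finset (Finset U)} (hX : IsPacking X) {S T : Finset U}
    (hS : S ∈ X) (hT : T ∈ X) {v : U} (hvS : v ∈ S) (hvT : v ∈ T) : S = T := by
  by_contra h
  exact Finset.disjoint_left.mp (hX.2 S hS T hT h) hvS hvT

theorem IsPacking.union {X Y : Finset (Finset U)} (hX : IsPacking X) (hY : IsPacking Y)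
    (h : Disjoint (X.biUnion id) (Y.biUnion id)) : IsPacking (X ∪ Y) := by
  have key : ∀ S ∈ X, ∀ T ∈ Y, Disjoint S T := fun S hS T hT =>
    h.mono (Finset.subset_biUnion_of_mem id hS) (Finset.subset_biUnion_of_mem id hT)
  refine ⟨fun S hS => ?_, fun S hS T hT hne => ?_⟩
  · rcases Finset.mem_union.mp hS with hS | hS
    exacts [hX.1 S hS, hY.1 S hS]
  · rcases Finset.mem_union.mp hS with hS | hS <;> rcases Finset.mem_union.mp hT with hT | hT
    exacts [hX.2 S hS T hT hne, key S hS T hT, (key T hT S hS).symm, hY.2 S hS T hT hne]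

theorem IsPacking.disjoint_family {X Y : Finset (Finset U)} (hX : IsPacking X)
    (h : Disjoint (X.biUnion id) (Y.biUnion id)) : Disjoint X Y := by
  rw [Finset.disjoint_left]
  intro S hS hS'
  obtain ⟨v, hv⟩ := hX.1 S hS
  exact Finset.disjoint_left.mp h (Finset.mem_biUnion.mpr ⟨S, hS, hv⟩)
    (Finset.mem_biUnion.mpr ⟨S, hS', hv⟩)

theorem IsPacking.sum_biUnion {X : Finset (Finset U)} (hX : IsPacking X) (g : U → ℤ) :
    ∑ v ∈ X.biUnion id, g v = ∑ S ∈ X, ∑ v ∈ S, g v :=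
  Finset.sum_biUnion fun S hS T hT hne => hX.2 S hS T hT hne

theorem IsPacking.singleton {S : Finset U} (hS : S.Nonempty) : IsPacking {S} := by
  refine ⟨by simpa using hS, fun A hA B hB hne => ?_⟩
  simp only [Finset.mem_singleton] at hA hB
  exact absurd (hA.trans hB.symm) hne

namespace LeveledSubmodular

variable {f : Finset β → Finset U → ℤ}

/-- Uncrossing a set with several disjoint sets all of which it meets. -/
theorem star (hf : LeveledSubmodular f) {K L : Finset β} {S : Finset U}
    {Q : Finset (Finset U)} (hne : Q.Nonempty)
    (hdisj : ∀ T ∈ Q, ∀ T' ∈ Q, T ≠ T' → Disjoint T T') (hmeet : ∀ T ∈ Q, (S ∩ T).Nonempty)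
    (M : Finset U → Finset β) (hM : ∀ T ∈ Q, K ⊆ M T ∧ M T ⊆ K ∪ L) :
    f (K ∪ L) (S ∪ Q.biUnion id) + ∑ T ∈ Q, f (K ∩ L) (S ∩ T) ≤
      f L S + ∑ T ∈ Q, f (M T) T := by
  induction hne using Finset.Nonempty.cons_induction with
  | singleton T =>
    have h := hf.submod L (M T) S T (hmeet T (by simp))
    obtain ⟨h1, h2⟩ := hM T (by simp)
    have e : L ∪ M T = K ∪ L := by
      ext a; simp only [Finset.mem_union]
      have := @h1 a; have := @h2 a; simp only [Finset.mem_union] at this; tauto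
    -- Submodularity leaves the intersection at the level `L ∩ M T`, which contains `K ∩ L`;
    -- monotonicity lowers it.
    have h3 : f (K ∩ L) (S ∩ T) ≤ f (L ∩ M T) (S ∩ T) := hf.mono _ (by
      intro a ha; simp only [Finset.mem_inter] at ha ⊢; exact ⟨ha.2, h1 ha.1⟩)
    simp only [Finset.singleton_biUnion, id, Finset.sum_singleton]
    rw [e] at h
    linarith
  | cons T Q hT hne ih =>
    rw [Finset.cons_eq_insert] at *
    have ih := ih (fun A hA B hB => hdisj A (by simp [hA]) B (by simp [hB]))
      (fun A hA => hmeet A (by simp [hA])) (fun A hA => hM A (by simp [hA]))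
    have hT' : Disjoint (Q.biUnion id) T := by
      rw [Finset.disjoint_biUnion_left]
      intro A hA
      exact hdisj A (by simp [hA]) T (by simp) (by rintro rfl; exact hT hA)
    -- The members of `Q` absorbed so far are disjoint from `T`, so the grown set has the same trace
    -- on `T` as `S`.
    have e1 : (S ∪ Q.biUnion id) ∩ T = S ∩ T := by
      rw [Finset.union_inter_distrib_right, Finset.disjoint_iff_inter_eq_empty.mp hT',
        Finset.union_empty]
    obtain ⟨h1, h2⟩ := hM T (by simp)
    have h := hf.submod (K ∪ L) (M T) (S ∪ Q.biUnion id) T (by rw [e1]; exact hmeet T (by simp))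
    have h3 : f (K ∩ L) (S ∩ T) ≤ f ((K ∪ L) ∩ M T) (S ∩ T) := hf.mono _ (by
      intro a ha
      simp only [Finset.mem_inter, Finset.mem_union] at ha ⊢
      exact ⟨Or.inl ha.1, h1 ha.1⟩)
    have e2 : S ∪ (insert T Q).biUnion id = (S ∪ Q.biUnion id) ∪ T := by
      rw [Finset.biUnion_insert, id, Finset.union_comm T, Finset.union_assoc]
    rw [Finset.sum_insert hT, Finset.sum_insert hT, e2]
    rw [e1, Finset.union_eq_left.mpr h2] at h
    linarith

/-- Uncrossing two packings such that every member of the second meets the first. -/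
theorem merge (hf : LeveledSubmodular f) (K L : Finset β) {X : Finset (Finset U)}
    (hX : IsPacking X) (X' : Finset (Finset U)) (hX' : IsPacking X')
    (hmeet : ∀ S ∈ X', ¬ Disjoint S (X.biUnion id)) :
    ∃ Y Y' : Finset (Finset U), IsPacking Y ∧ IsPacking Y' ∧
      Y.biUnion id =
        (X.filter fun S => ¬ Disjoint S (X'.biUnion id)).biUnion id ∪ X'.biUnion id ∧
      Y'.biUnion id = X.biUnion id ∩ X'.biUnion id ∧
      (∀ S ∈ (X.filter fun S => ¬ Disjoint S (X'.biUnion id)) ∪ X', ∃ Z ∈ Y, S ⊆ Z) ∧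
      ∑ Z ∈ Y, f (K ∪ L) Z + ∑ Z ∈ Y', f (K ∩ L) Z ≤
        ∑ S ∈ X with ¬ Disjoint S (X'.biUnion id), f K S + ∑ S ∈ X', f L S := by
  have union_aux : ∀ A B C D : Finset U, A ∪ (B ∪ C) ∪ D = (B ∪ D) ∪ (A ∪ C) := by
    intro A B C D
    ext v; simp only [Finset.mem_union]; tauto
  induction X' using Finset.induction_on with
  | empty =>
    refine ⟨∅, ∅, ?_, ?_, ?_⟩
    · simp [IsPacking]
    · simp [IsPacking]
    · simp
  | insert S X' hS ih =>
    obtain ⟨Y, Y', hY, hY', hYu, hYu', hsub, hle⟩ := ih (hX'.mono (Finset.subset_insert _ _))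
      (fun T hT => hmeet T (Finset.mem_insert_of_mem hT))
    set W := X'.biUnion id with hW
    set Xm := X.filter fun T => ¬ Disjoint T W with hXm
    have hWi : (insert S X').biUnion id = S ∪ W := by simp [hW]
    rw [hWi]
    have hSW : Disjoint S W := by
      rw [hW, Finset.disjoint_biUnion_right]
      intro T hT
      exact hX'.2 S (by simp) T (by simp [hT]) (by rintro rfl; exact hS hT)
    -- The new set `S` absorbs two kinds of sets: `Q`, members of `Y` already raised to level `K ∪
    -- L`, and `N`, members of `X` not met before and still at level `K`. They are pairwise
    -- disjoint, so `star` applies with mixed levels.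
    set N := X.filter fun T => Disjoint T W ∧ ¬ Disjoint T S with hN
    set Q := Y.filter fun T => ¬ Disjoint T S with hQ
    have hXmN : X.filter (fun T => ¬ Disjoint T (S ∪ W)) = Xm ∪ N := by
      ext T
      simp only [hXm, hN, Finset.mem_filter, Finset.mem_union, Finset.disjoint_union_right]
      by_cases h1 : Disjoint T W <;> by_cases h2 : Disjoint T S <;> simp [h1, h2]
    have hXmNd : Disjoint Xm N := by
      rw [Finset.disjoint_left]; intro T h1 h2
      exact (Finset.mem_filter.mp h1).2 (Finset.mem_filter.mp h2).2.1
    have hNY : ∀ T ∈ N, Disjoint T (Y.biUnion id) := by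
      intro T hT
      obtain ⟨hTX, hTW, -⟩ := Finset.mem_filter.mp hT
      rw [hYu, Finset.disjoint_union_right, Finset.disjoint_biUnion_right]
      refine ⟨fun T' hT' => ?_, hTW⟩
      obtain ⟨hTX', hTW'⟩ := Finset.mem_filter.mp hT'
      exact hX.2 T hTX T' hTX' (by rintro rfl; exact hTW' hTW)
    have hNYt : ∀ T ∈ N, ∀ Z ∈ Y, Disjoint T Z := fun T hT Z hZ =>
      (hNY T hT).mono_right (Finset.subset_biUnion_of_mem id hZ)
    have hXN : ∀ T ∈ N, T ∈ X := fun T hT => (Finset.mem_filter.mp hT).1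
    have hQY : ∀ T ∈ Q, T ∈ Y := fun T hT => (Finset.mem_filter.mp hT).1
    have hNp : IsPacking N := hX.mono (Finset.filter_subset _ _)
    have hQp : IsPacking Q := hY.mono (Finset.filter_subset _ _)
    have hNQd : Disjoint N Q := by
      rw [Finset.disjoint_left]; intro T h1 h2
      have := hNYt T h1 T (hQY T h2)
      rw [disjoint_self] at this
      exact (hX.1 T (hXN T h1)).ne_empty this
    have hQN : IsPacking (Q ∪ N) := hQp.union hNp (by
      rw [Finset.disjoint_biUnion_left]
      intro Z hZ
      rw [Finset.disjoint_biUnion_right]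
      exact fun T hT => (hNYt T hT Z (hQY Z hZ)).symm)
    have hQNne : (Q ∪ N).Nonempty := by
      have h := hmeet S (by simp)
      rw [Finset.not_disjoint_iff] at h
      obtain ⟨v, hvS, hv⟩ := h
      obtain ⟨T, hT, hvT⟩ := Finset.mem_biUnion.mp hv
      have hTS : ¬ Disjoint T S := Finset.not_disjoint_iff.mpr ⟨v, hvT, hvS⟩
      by_cases hTW : Disjoint T W
      · exact ⟨T, Finset.mem_union_right _ (Finset.mem_filter.mpr ⟨hT, hTW, hTS⟩)⟩
      · have : v ∈ Y.biUnion id := by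
          rw [hYu]
          exact Finset.mem_union_left _ (Finset.mem_biUnion.mpr
            ⟨T, Finset.mem_filter.mpr ⟨hT, hTW⟩, hvT⟩)
        obtain ⟨Z, hZ, hvZ⟩ := Finset.mem_biUnion.mp this
        exact ⟨Z, Finset.mem_union_left _ (Finset.mem_filter.mpr
          ⟨hZ, Finset.not_disjoint_iff.mpr ⟨v, hvZ, hvS⟩⟩)⟩
    have hQNmeet : ∀ T ∈ Q ∪ N, (S ∩ T).Nonempty := by
      intro T hT
      have : ¬ Disjoint T S := by
        rcases Finset.mem_union.mp hT with h | h
        exacts [(Finset.mem_filter.mp h).2, (Finset.mem_filter.mp h).2.2]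
      rw [disjoint_comm, Finset.disjoint_iff_inter_eq_empty] at this
      exact Finset.nonempty_iff_ne_empty.mpr this
    have hstar := hf.star (K := K) (L := L) hQNne hQN.2 hQNmeet
      (fun T => if T ∈ Q then K ∪ L else K) (by
        intro T hT
        split_ifs
        · exact ⟨Finset.subset_union_left, le_rfl⟩
        · exact ⟨le_rfl, Finset.subset_union_left⟩)
    rw [Finset.sum_union hNQd.symm] at hstar
    have es1 : ∑ T ∈ Q, f (if T ∈ Q then K ∪ L else K) T = ∑ T ∈ Q, f (K ∪ L) T :=
      Finset.sum_congr rfl fun T hT => by rw [if_pos hT]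
    have es2 : ∑ T ∈ N, f (if T ∈ Q then K ∪ L else K) T = ∑ T ∈ N, f K T :=
      Finset.sum_congr rfl fun T hT => by rw [if_neg (Finset.disjoint_left.mp hNQd hT)]
    rw [Finset.sum_union hNQd.symm, es1, es2] at hstar
    set B := S ∪ (Q ∪ N).biUnion id with hB
    set Yr := Y.filter fun T => Disjoint T S with hYr
    have hYsplit : ∑ Z ∈ Y, f (K ∪ L) Z = ∑ Z ∈ Yr, f (K ∪ L) Z + ∑ Z ∈ Q, f (K ∪ L) Z :=
      (Finset.sum_filter_add_sum_filter_not _ _ _).symm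
    have hYrp : IsPacking Yr := hY.mono (Finset.filter_subset _ _)
    have hYrB : Disjoint (Yr.biUnion id) B := by
      rw [Finset.disjoint_biUnion_left]
      intro T hT
      obtain ⟨hTY, hTS⟩ := Finset.mem_filter.mp hT
      rw [hB, Finset.disjoint_union_right, Finset.disjoint_biUnion_right]
      refine ⟨hTS, fun Z hZ => ?_⟩
      rcases Finset.mem_union.mp hZ with h | h
      · exact hY.2 T hTY Z (hQY Z h) (by
          rintro rfl; exact (Finset.mem_filter.mp h).2 hTS)
      · exact (hNYt Z h T hTY).symm
    have hSne : S.Nonempty := hX'.1 S (by simp)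
    have hBne : B.Nonempty := hSne.mono Finset.subset_union_left
    have hnotB : B ∉ Yr := fun h => by
      have : Disjoint B B := (Finset.disjoint_biUnion_left Yr id B).mp hYrB B h
      exact hBne.ne_empty (disjoint_self.mp this)
    set I := (Q ∪ N).image fun T => S ∩ T with hI
    have hinj : ∀ T ∈ Q ∪ N, ∀ T' ∈ Q ∪ N, S ∩ T = S ∩ T' → T = T' := by
      intro T hT T' hT' h
      obtain ⟨v, hv⟩ := hQNmeet T hT
      have hv' := hv
      rw [h] at hv'
      exact hQN.eq_of_mem hT hT' (Finset.mem_inter.mp hv).2 (Finset.mem_inter.mp hv').2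
    have hIsum : ∑ Z ∈ I, f (K ∩ L) Z =
        ∑ T ∈ Q, f (K ∩ L) (S ∩ T) + ∑ T ∈ N, f (K ∩ L) (S ∩ T) := by
      rw [hI, Finset.sum_image hinj, Finset.sum_union hNQd.symm]
    have hIu : I.biUnion id = S ∩ X.biUnion id := by
      ext v
      simp only [hI, Finset.mem_biUnion, Finset.mem_image, id, Finset.mem_inter]
      constructor
      · rintro ⟨_, ⟨T, hT, rfl⟩, hv⟩
        obtain ⟨hvS, hvT⟩ := Finset.mem_inter.mp hv
        refine ⟨hvS, ?_⟩
        rcases Finset.mem_union.mp hT with h | h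
        · have : v ∈ Y.biUnion id := Finset.mem_biUnion.mpr ⟨T, hQY T h, hvT⟩
          rw [hYu, Finset.mem_union] at this
          rcases this with h' | h'
          · obtain ⟨A, hA, hvA⟩ := Finset.mem_biUnion.mp h'
            exact ⟨A, (Finset.mem_filter.mp hA).1, hvA⟩
          · exact absurd h' (Finset.disjoint_left.mp hSW hvS)
        · exact ⟨T, hXN T h, hvT⟩
      · rintro ⟨hvS, T, hT, hvT⟩
        by_cases hTW : Disjoint T W
        · exact ⟨S ∩ T, ⟨T, Finset.mem_union_right _ (Finset.mem_filter.mpr ⟨hT, hTW,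
            Finset.not_disjoint_iff.mpr ⟨v, hvT, hvS⟩⟩), rfl⟩, Finset.mem_inter.mpr ⟨hvS, hvT⟩⟩
        · have : v ∈ Y.biUnion id := by
            rw [hYu]
            exact Finset.mem_union_left _ (Finset.mem_biUnion.mpr
              ⟨T, Finset.mem_filter.mpr ⟨hT, hTW⟩, hvT⟩)
          obtain ⟨Z, hZ, hvZ⟩ := Finset.mem_biUnion.mp this
          exact ⟨S ∩ Z, ⟨Z, Finset.mem_union_left _ (Finset.mem_filter.mpr ⟨hZ,
            Finset.not_disjoint_iff.mpr ⟨v, hvZ, hvS⟩⟩), rfl⟩, Finset.mem_inter.mpr ⟨hvS, hvZ⟩⟩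
    have hIp : IsPacking I := by
      refine ⟨fun Z hZ => ?_, fun Z hZ Z' hZ' hne => ?_⟩
      · obtain ⟨T, hT, rfl⟩ := Finset.mem_image.mp hZ
        exact hQNmeet T hT
      · obtain ⟨T, hT, rfl⟩ := Finset.mem_image.mp hZ
        obtain ⟨T', hT', rfl⟩ := Finset.mem_image.mp hZ'
        exact (hQN.2 T hT T' hT' (by rintro rfl; exact hne rfl)).mono
          Finset.inter_subset_right Finset.inter_subset_right
    have hYI : Disjoint (Y'.biUnion id) (I.biUnion id) := by
      rw [hYu', hIu]
      exact (hSW.symm).mono Finset.inter_subset_right Finset.inter_subset_left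
    have hYId : Disjoint Y' I := hY'.disjoint_family hYI
    refine ⟨insert B Yr, Y' ∪ I, ?_, hY'.union hIp hYI, ?_, ?_, ?_, ?_⟩
    · rw [Finset.insert_eq, Finset.union_comm]
      exact hYrp.union (IsPacking.singleton hBne) (by simpa using hYrB)
    · have : (insert B Yr).biUnion id = S ∪ Y.biUnion id ∪ N.biUnion id := by
        ext v
        simp only [Finset.biUnion_insert, id, hB, Finset.mem_union, Finset.mem_biUnion, hYr, hQ,
          Finset.mem_filter]
        constructor
        · rintro ((h | ⟨T, hT | hT, hv⟩) | ⟨T, hT, hv⟩)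
          · exact Or.inl (Or.inl h)
          · exact Or.inl (Or.inr ⟨T, hT.1, hv⟩)
          · exact Or.inr ⟨T, hT, hv⟩
          · exact Or.inl (Or.inr ⟨T, hT.1, hv⟩)
        · rintro ((h | ⟨T, hT, hv⟩) | ⟨T, hT, hv⟩)
          · exact Or.inl (Or.inl h)
          · by_cases hTS : Disjoint T S
            · exact Or.inr ⟨T, ⟨hT, hTS⟩, hv⟩
            · exact Or.inl (Or.inr ⟨T, Or.inl ⟨hT, hTS⟩, hv⟩)
          · exact Or.inl (Or.inr ⟨T, Or.inr hT, hv⟩)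
      rw [this, hYu, hXmN, Finset.union_biUnion, union_aux]
    · rw [Finset.union_biUnion, hYu', hIu, Finset.inter_comm S, Finset.inter_union_distrib_left,
        Finset.union_comm]
    · have hY2 : ∀ Z ∈ Y, ∃ Z' ∈ insert B Yr, Z ⊆ Z' := by
        intro Z hZ
        by_cases hZS : Disjoint Z S
        · exact ⟨Z, Finset.mem_insert_of_mem (Finset.mem_filter.mpr ⟨hZ, hZS⟩), le_rfl⟩
        · refine ⟨B, Finset.mem_insert_self _ _, ?_⟩
          have : Z ∈ Q ∪ N := Finset.mem_union_left _ (Finset.mem_filter.mpr ⟨hZ, hZS⟩)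
          exact (Finset.subset_biUnion_of_mem id this).trans Finset.subset_union_right
      intro T hT
      rw [hXmN] at hT
      have hcase : T = S ∨ T ∈ N ∨ T ∈ Xm ∪ X' := by
        rcases Finset.mem_union.mp hT with h | h
        · rcases Finset.mem_union.mp h with h | h
          · exact Or.inr (Or.inr (Finset.mem_union_left _ h))
          · exact Or.inr (Or.inl h)
        · rcases Finset.mem_insert.mp h with h | h
          · exact Or.inl h
          · exact Or.inr (Or.inr (Finset.mem_union_right _ h))
      rcases hcase with rfl | h | h
      · exact ⟨B, Finset.mem_insert_self _ _, Finset.subset_union_left⟩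
      · exact ⟨B, Finset.mem_insert_self _ _,
          (Finset.subset_biUnion_of_mem id (Finset.mem_union_right Q h)).trans
            Finset.subset_union_right⟩
      · obtain ⟨Z, hZ, hTZ⟩ := hsub T h
        obtain ⟨Z', hZ', h'⟩ := hY2 Z hZ
        exact ⟨Z', hZ', hTZ.trans h'⟩
    · rw [Finset.sum_insert hnotB, Finset.sum_union hYId, hIsum, hXmN, Finset.sum_union hXmNd,
        Finset.sum_insert hS]
      linarith

end LeveledSubmodular

end Uncrossing

/-! ### Uncrossing when uncovered points carry weights. -/

section UncrossingWeights

variable {U β : Type*} [DecidableEq U] [DecidableEq β]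

theorem sum_eq_sum_ite_of_subset {V T : Finset U} (h : T ⊆ V) (g : U → ℤ) :
    ∑ v ∈ T, g v = ∑ v ∈ V, if v ∈ T then g v else 0 := by
  rw [Finset.sum_ite_mem, Finset.inter_eq_right.mpr h]

theorem sum_sdiff_eq_sum_ite (V T : Finset U) (g : U → ℤ) :
    ∑ v ∈ V \ T, g v = ∑ v ∈ V, if v ∈ T then 0 else g v := by
  rw [sum_eq_sum_ite_of_subset Finset.sdiff_subset]
  refine Finset.sum_congr rfl fun v hv => ?_
  by_cases h : v ∈ T <;> simp [h, hv]

namespace LeveledSubmodular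

variable {f : Finset β → Finset U → ℤ}

/-- Uncrossing two packings `X`, `X'` in `V` at the levels `K`, `L`, where uncovered points carry
weights. A member of one packing that is disjoint from the other is placed at the upper level if it
satisfies `G` and at the lower level otherwise. -/
theorem uncross (hf : LeveledSubmodular f) (V : Finset U) (K L : Finset β)
    {X X' : Finset (Finset U)} (hX : IsPacking X) (hX' : IsPacking X')
    (hXV : X.biUnion id ⊆ V) (hXV' : X'.biUnion id ⊆ V) (s₁ s₂ s₃ s₄ : U → ℤ)
    (G : Finset U → Prop)
    (h0 : ∀ v, v ∉ X.biUnion id → v ∉ X'.biUnion id → s₃ v + s₄ v ≤ s₁ v + s₂ v)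
    (h1 : ∀ v, v ∉ X.biUnion id → v ∈ X'.biUnion id → s₄ v ≤ s₁ v)
    (h2 : ∀ v, v ∈ X.biUnion id → v ∉ X'.biUnion id → s₄ v ≤ s₂ v)
    (hG : ∀ S ∈ X, Disjoint S (X'.biUnion id) → G S →
      f (K ∪ L) S + ∑ v ∈ S, s₄ v ≤ f K S + ∑ v ∈ S, s₂ v)
    (hG' : ∀ S ∈ X', Disjoint S (X.biUnion id) → G S →
      f (K ∪ L) S + ∑ v ∈ S, s₄ v ≤ f L S + ∑ v ∈ S, s₁ v)
    (hN : ∀ S ∈ X, Disjoint S (X'.biUnion id) → ¬ G S → ∀ v ∈ S, s₃ v ≤ s₂ v)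
    (hN' : ∀ S ∈ X', Disjoint S (X.biUnion id) → ¬ G S → ∀ v ∈ S, s₃ v ≤ s₁ v) :
    ∃ Y Y' : Finset (Finset U), IsPacking Y ∧ IsPacking Y' ∧
      Y.biUnion id ⊆ V ∧ Y'.biUnion id ⊆ V ∧
      (∀ S ∈ X, ¬ Disjoint S (X'.biUnion id) → ∃ Z ∈ Y, S ⊆ Z) ∧
      (∀ S ∈ X', ¬ Disjoint S (X.biUnion id) → ∃ Z ∈ Y, S ⊆ Z) ∧
      (∀ S ∈ X', Disjoint S (X.biUnion id) → ¬ G S → S ∈ Y') ∧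
      (∀ v ∈ Y'.biUnion id, v ∈ X.biUnion id ∨
        ∃ S ∈ X', Disjoint S (X.biUnion id) ∧ ¬ G S ∧ v ∈ S) ∧
      (∑ Z ∈ Y, f (K ∪ L) Z + ∑ v ∈ V \ Y.biUnion id, s₃ v) +
        (∑ Z ∈ Y', f (K ∩ L) Z + ∑ v ∈ V \ Y'.biUnion id, s₄ v) ≤
      (∑ S ∈ X, f K S + ∑ v ∈ V \ X.biUnion id, s₁ v) +
        (∑ S ∈ X', f L S + ∑ v ∈ V \ X'.biUnion id, s₂ v) := by
  classical
  set P := X.biUnion id with hP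
  set P' := X'.biUnion id with hP'
  -- `m` marks the sets that meet the other packing, to be merged; among the rest, those marked `G`
  -- will join the upper packing and those marked `N` the lower one.
  set Xm := X.filter fun S => ¬ Disjoint S P' with hXm
  set Xm' := X'.filter fun S => ¬ Disjoint S P with hXm'
  set XG := X.filter fun S => Disjoint S P' ∧ G S with hXG
  set XN := X.filter fun S => Disjoint S P' ∧ ¬ G S with hXN
  set XG' := X'.filter fun S => Disjoint S P ∧ G S with hXG'
  set XN' := X'.filter fun S => Disjoint S P ∧ ¬ G S with hXN'
  obtain ⟨Y, Y', hY, hY', hYu, hYu', hsub, hle⟩ := hf.merge K L hX Xm'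
    (hX'.mono (Finset.filter_subset _ _)) (fun S hS => (Finset.mem_filter.mp hS).2)
  have hmem : ∀ {T : Finset U} {v : U}, T ∈ X → v ∈ T → v ∈ P := fun hT hv =>
    Finset.mem_biUnion.mpr ⟨_, hT, hv⟩
  have hmem' : ∀ {T : Finset U} {v : U}, T ∈ X' → v ∈ T → v ∈ P' := fun hT hv =>
    Finset.mem_biUnion.mpr ⟨_, hT, hv⟩
  -- A member of `X` that meets some member of `X'` meets one in `Xm'`, so merging with `Xm'` alone
  -- loses nothing.
  have hXmeq : (X.filter fun S => ¬ Disjoint S (Xm'.biUnion id)) = Xm := by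
    refine Finset.filter_congr fun S hS => not_congr ⟨fun h => ?_, fun h => ?_⟩
    · rw [Finset.disjoint_left]
      intro v hvS hv
      obtain ⟨T, hT, hvT⟩ := Finset.mem_biUnion.mp hv
      exact Finset.disjoint_left.mp h hvS (Finset.mem_biUnion.mpr ⟨T, Finset.mem_filter.mpr
        ⟨hT, Finset.not_disjoint_iff.mpr ⟨v, hvT, hmem hS hvS⟩⟩, hvT⟩)
    · exact h.mono_right (Finset.biUnion_subset_biUnion_of_subset_left _
        (Finset.filter_subset _ _))
  rw [hXmeq] at hYu hsub hle
  set M := Xm.biUnion id with hM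
  set M' := Xm'.biUnion id with hM'
  set AG := XG.biUnion id with hAG
  set AN := XN.biUnion id with hAN
  set BG := XG'.biUnion id with hBG
  set BN := XN'.biUnion id with hBN
  -- the sums over the families
  have split : ∀ (Z : Finset (Finset U)) (T : Finset U) (g : Finset U → ℤ),
      ∑ S ∈ Z, g S = ∑ S ∈ Z with ¬ Disjoint S T, g S + ∑ S ∈ Z with Disjoint S T ∧ G S, g S +
        ∑ S ∈ Z with Disjoint S T ∧ ¬ G S, g S := by
    intro Z T g
    rw [← Finset.sum_filter_not_add_sum_filter Z (fun S => Disjoint S T),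
      ← Finset.sum_filter_add_sum_filter_not (Z.filter fun S => Disjoint S T) G,
      Finset.filter_filter, Finset.filter_filter, add_assoc]
  have hPmem : ∀ v, v ∈ P ↔ v ∈ M ∨ v ∈ AG ∨ v ∈ AN := by
    intro v
    simp only [hP, hM, hAG, hAN, hXm, hXG, hXN, Finset.mem_biUnion, Finset.mem_filter, id]
    constructor
    · rintro ⟨S, hS, hv⟩
      by_cases h : Disjoint S P'
      · by_cases hg : G S
        exacts [Or.inr (Or.inl ⟨S, ⟨hS, h, hg⟩, hv⟩), Or.inr (Or.inr ⟨S, ⟨hS, h, hg⟩, hv⟩)]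
      · exact Or.inl ⟨S, ⟨hS, h⟩, hv⟩
    · rintro (⟨S, hS, hv⟩ | ⟨S, hS, hv⟩ | ⟨S, hS, hv⟩) <;> exact ⟨S, hS.1, hv⟩
  have hPmem' : ∀ v, v ∈ P' ↔ v ∈ M' ∨ v ∈ BG ∨ v ∈ BN := by
    intro v
    simp only [hP', hM', hBG, hBN, hXm', hXG', hXN', Finset.mem_biUnion, Finset.mem_filter, id]
    constructor
    · rintro ⟨S, hS, hv⟩
      by_cases h : Disjoint S P
      · by_cases hg : G S
        exacts [Or.inr (Or.inl ⟨S, ⟨hS, h, hg⟩, hv⟩), Or.inr (Or.inr ⟨S, ⟨hS, h, hg⟩, hv⟩)]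
      · exact Or.inl ⟨S, ⟨hS, h⟩, hv⟩
    · rintro (⟨S, hS, hv⟩ | ⟨S, hS, hv⟩ | ⟨S, hS, hv⟩) <;> exact ⟨S, hS.1, hv⟩
  have single : ∀ v, (v ∈ AG ∨ v ∈ AN) → v ∉ P' ∧ v ∉ M ∧ ¬ (v ∈ AG ∧ v ∈ AN) := by
    intro v hv
    have : ∃ S ∈ X, Disjoint S P' ∧ v ∈ S := by
      rcases hv with hv | hv <;> obtain ⟨S, hS, hvS⟩ := Finset.mem_biUnion.mp hv <;>
        obtain ⟨hS, hd, -⟩ := Finset.mem_filter.mp hS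
      exacts [⟨S, hS, hd, hvS⟩, ⟨S, hS, hd, hvS⟩]
    obtain ⟨S, hS, hd, hvS⟩ := this
    refine ⟨Finset.disjoint_left.mp hd hvS, fun h => ?_, fun h => ?_⟩
    · obtain ⟨T, hT, hvT⟩ := Finset.mem_biUnion.mp h
      obtain ⟨hT, hTd⟩ := Finset.mem_filter.mp hT
      exact hTd (hX.eq_of_mem hS hT hvS hvT ▸ hd)
    · obtain ⟨T, hT, hvT⟩ := Finset.mem_biUnion.mp h.1
      obtain ⟨T', hT', hvT'⟩ := Finset.mem_biUnion.mp h.2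
      obtain ⟨hT, -, hg⟩ := Finset.mem_filter.mp hT
      obtain ⟨hT', -, hg'⟩ := Finset.mem_filter.mp hT'
      exact hg' (hX.eq_of_mem hT hT' hvT hvT' ▸ hg)
  have single' : ∀ v, (v ∈ BG ∨ v ∈ BN) → v ∉ P ∧ v ∉ M' ∧ ¬ (v ∈ BG ∧ v ∈ BN) := by
    intro v hv
    have : ∃ S ∈ X', Disjoint S P ∧ v ∈ S := by
      rcases hv with hv | hv <;> obtain ⟨S, hS, hvS⟩ := Finset.mem_biUnion.mp hv <;>
        obtain ⟨hS, hd, -⟩ := Finset.mem_filter.mp hS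
      exacts [⟨S, hS, hd, hvS⟩, ⟨S, hS, hd, hvS⟩]
    obtain ⟨S, hS, hd, hvS⟩ := this
    refine ⟨Finset.disjoint_left.mp hd hvS, fun h => ?_, fun h => ?_⟩
    · obtain ⟨T, hT, hvT⟩ := Finset.mem_biUnion.mp h
      obtain ⟨hT, hTd⟩ := Finset.mem_filter.mp hT
      exact hTd (hX'.eq_of_mem hS hT hvS hvT ▸ hd)
    · obtain ⟨T, hT, hvT⟩ := Finset.mem_biUnion.mp h.1
      obtain ⟨T', hT', hvT'⟩ := Finset.mem_biUnion.mp h.2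
      obtain ⟨hT, -, hg⟩ := Finset.mem_filter.mp hT
      obtain ⟨hT', -, hg'⟩ := Finset.mem_filter.mp hT'
      exact hg' (hX'.eq_of_mem hT hT' hvT hvT' ▸ hg)
  have dAB : Disjoint AG BG := Finset.disjoint_left.mpr fun v hv hv' =>
    (single v (Or.inl hv)).1 ((hPmem' v).mpr (Or.inr (Or.inl hv')))
  have dABN : Disjoint AN BN := Finset.disjoint_left.mpr fun v hv hv' =>
    (single v (Or.inr hv)).1 ((hPmem' v).mpr (Or.inr (Or.inr hv')))
  have dY : Disjoint (Y.biUnion id) ((XG ∪ XG').biUnion id) := by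
    rw [hYu, Finset.union_biUnion, ← hAG, ← hBG, Finset.disjoint_left]
    intro v hv hv'
    rcases Finset.mem_union.mp hv' with h | h
    · have := single v (Or.inl h)
      rcases Finset.mem_union.mp hv with h' | h'
      exacts [this.2.1 h', this.1 ((hPmem' v).mpr (Or.inl h'))]
    · have := single' v (Or.inl h)
      rcases Finset.mem_union.mp hv with h' | h'
      exacts [this.1 ((hPmem v).mpr (Or.inl h')), this.2.1 h']
  have dY' : Disjoint (Y'.biUnion id) ((XN ∪ XN').biUnion id) := by
    rw [hYu', Finset.union_biUnion, ← hAN, ← hBN, Finset.disjoint_left]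
    intro v hv hv'
    obtain ⟨h1, h2⟩ := Finset.mem_inter.mp hv
    rcases Finset.mem_union.mp hv' with h | h
    · exact (single v (Or.inr h)).1 ((hPmem' v).mpr (Or.inl h2))
    · exact (single' v (Or.inr h)).1 h1
  have pXG : IsPacking XG := hX.mono (Finset.filter_subset _ _)
  have pXN : IsPacking XN := hX.mono (Finset.filter_subset _ _)
  have pXG' : IsPacking XG' := hX'.mono (Finset.filter_subset _ _)
  have pXN' : IsPacking XN' := hX'.mono (Finset.filter_subset _ _)
  have pG : IsPacking (XG ∪ XG') := pXG.union pXG' dAB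
  have pN : IsPacking (XN ∪ XN') := pXN.union pXN' dABN
  have uY : (Y ∪ (XG ∪ XG')).biUnion id = (M ∪ M') ∪ (AG ∪ BG) := by
    rw [Finset.union_biUnion, Finset.union_biUnion, hYu]
  have uY' : (Y' ∪ (XN ∪ XN')).biUnion id = (P ∩ M') ∪ (AN ∪ BN) := by
    rw [Finset.union_biUnion, Finset.union_biUnion, hYu']
  have sMP : ∀ v ∈ M, v ∈ P := fun v hv => (hPmem v).mpr (Or.inl hv)
  have sAG : AG ⊆ P := fun v hv => (hPmem v).mpr (Or.inr (Or.inl hv))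
  have sAN : AN ⊆ P := fun v hv => (hPmem v).mpr (Or.inr (Or.inr hv))
  have sMP' : ∀ v ∈ M', v ∈ P' := fun v hv => (hPmem' v).mpr (Or.inl hv)
  have sBG : BG ⊆ P' := fun v hv => (hPmem' v).mpr (Or.inr (Or.inl hv))
  have sBN : BN ⊆ P' := fun v hv => (hPmem' v).mpr (Or.inr (Or.inr hv))
  refine ⟨Y ∪ (XG ∪ XG'), Y' ∪ (XN ∪ XN'), hY.union pG dY, hY'.union pN dY', ?_, ?_, ?_, ?_, ?_,
    ?_, ?_⟩
  · rw [uY]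
    exact Finset.union_subset (Finset.union_subset (fun v hv => hXV (sMP v hv))
      fun v hv => hXV' (sMP' v hv)) (Finset.union_subset (sAG.trans hXV) (sBG.trans hXV'))
  · rw [uY']
    exact Finset.union_subset (fun v hv => hXV (Finset.mem_inter.mp hv).1)
      (Finset.union_subset (sAN.trans hXV) (sBN.trans hXV'))
  · intro S hS hd
    obtain ⟨Z, hZ, hSZ⟩ := hsub S (Finset.mem_union_left _ (Finset.mem_filter.mpr ⟨hS, hd⟩))
    exact ⟨Z, Finset.mem_union_left _ hZ, hSZ⟩
  · intro S hS hd
    obtain ⟨Z, hZ, hSZ⟩ := hsub S (Finset.mem_union_right _ (Finset.mem_filter.mpr ⟨hS, hd⟩))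
    exact ⟨Z, Finset.mem_union_left _ hZ, hSZ⟩
  · intro S hS hd hg
    exact Finset.mem_union_right _ (Finset.mem_union_right _ (Finset.mem_filter.mpr ⟨hS, hd, hg⟩))
  · intro v hv
    rw [uY'] at hv
    rcases Finset.mem_union.mp hv with h | h
    · exact Or.inl (Finset.mem_inter.mp h).1
    · rcases Finset.mem_union.mp h with h | h
      · exact Or.inl (sAN h)
      · obtain ⟨S, hS, hvS⟩ := Finset.mem_biUnion.mp h
        obtain ⟨hS, hd, hg⟩ := Finset.mem_filter.mp hS
        exact Or.inr ⟨S, hS, hd, hg, hvS⟩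
  · have sumG : ∑ S ∈ XG, f (K ∪ L) S + ∑ v ∈ AG, s₄ v ≤ ∑ S ∈ XG, f K S + ∑ v ∈ AG, s₂ v := by
      rw [hAG, pXG.sum_biUnion, pXG.sum_biUnion, ← Finset.sum_add_distrib,
        ← Finset.sum_add_distrib]
      refine Finset.sum_le_sum fun S hS => ?_
      obtain ⟨hS, hd, hg⟩ := Finset.mem_filter.mp hS
      exact hG S hS hd hg
    have sumG' : ∑ S ∈ XG', f (K ∪ L) S + ∑ v ∈ BG, s₄ v ≤
        ∑ S ∈ XG', f L S + ∑ v ∈ BG, s₁ v := by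
      rw [hBG, pXG'.sum_biUnion, pXG'.sum_biUnion, ← Finset.sum_add_distrib,
        ← Finset.sum_add_distrib]
      refine Finset.sum_le_sum fun S hS => ?_
      obtain ⟨hS, hd, hg⟩ := Finset.mem_filter.mp hS
      exact hG' S hS hd hg
    have sumN : ∑ S ∈ XN, f (K ∩ L) S ≤ ∑ S ∈ XN, f K S :=
      Finset.sum_le_sum fun S _ => hf.mono S Finset.inter_subset_left
    have sumN' : ∑ S ∈ XN', f (K ∩ L) S ≤ ∑ S ∈ XN', f L S :=
      Finset.sum_le_sum fun S _ => hf.mono S Finset.inter_subset_right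
    have hANs : ∀ v ∈ AN, s₃ v ≤ s₂ v := by
      intro v hv
      obtain ⟨S, hS, hvS⟩ := Finset.mem_biUnion.mp hv
      obtain ⟨hS, hd, hg⟩ := Finset.mem_filter.mp hS
      exact hN S hS hd hg v hvS
    have hBNs : ∀ v ∈ BN, s₃ v ≤ s₁ v := by
      intro v hv
      obtain ⟨S, hS, hvS⟩ := Finset.mem_biUnion.mp hv
      obtain ⟨hS, hd, hg⟩ := Finset.mem_filter.mp hS
      exact hN' S hS hd hg v hvS
    -- The weights compare vertex by vertex, except on `AG` and `BG`: there only the total over each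
    -- set, together with `f`, is controlled, so these sums are carried on both sides.
    have weights : ∑ v ∈ V \ (Y ∪ (XG ∪ XG')).biUnion id, s₃ v +
        ∑ v ∈ V \ (Y' ∪ (XN ∪ XN')).biUnion id, s₄ v + ∑ v ∈ AG, s₂ v + ∑ v ∈ BG, s₁ v ≤
        ∑ v ∈ V \ P, s₁ v + ∑ v ∈ V \ P', s₂ v + ∑ v ∈ AG, s₄ v + ∑ v ∈ BG, s₄ v := by
      rw [uY, uY']
      simp only [sum_sdiff_eq_sum_ite, sum_eq_sum_ite_of_subset (sAG.trans hXV),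
        sum_eq_sum_ite_of_subset (sBG.trans hXV'), ← Finset.sum_add_distrib]
      refine Finset.sum_le_sum fun v _ => ?_
      simp only [Finset.mem_union, Finset.mem_inter]
      have p1 := hPmem v
      have p2 := hPmem' v
      have q1 := single v
      have q2 := single' v
      have r0 := h0 v
      have r1 := h1 v
      have r2 := h2 v
      have t1 := hANs v
      have t2 := hBNs v
      clear * - p1 p2 q1 q2 r0 r1 r2 t1 t2
      by_cases a1 : v ∈ P <;> by_cases a2 : v ∈ P' <;> by_cases a3 : v ∈ AG <;>
        by_cases a4 : v ∈ BG <;> by_cases a5 : v ∈ AN <;> by_cases a6 : v ∈ BN <;>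
        by_cases a7 : v ∈ M <;> by_cases a8 : v ∈ M' <;>
        simp_all <;> linarith
    rw [Finset.sum_union (hY.disjoint_family dY), Finset.sum_union (pXG.disjoint_family dAB),
      Finset.sum_union (hY'.disjoint_family dY'), Finset.sum_union (pXN.disjoint_family dABN),
      split X P', split X' P]
    linarith

end LeveledSubmodular

end UncrossingWeights

/-! ### Demands, tight packings and their uncrossing. -/

/-- Numerical data of a family of partial arborescences: the ground set `V`, the block of each
index, the vertex set of each member, the number `d` of free arcs entering a set, the number `n` of
free arcs from the root to a vertex, and the demand `c` of each block for further root arcs. -/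
structure RootData (U ι β : Type*) where
  V : Finset U
  block : ι → β
  R : ι → Finset U
  d : Finset U → ℤ
  n : U → ℤ
  c : β → ℤ

namespace RootData

variable {U ι β : Type*} [DecidableEq U] [DecidableEq β] [Fintype ι] [DecidableEq ι]
  (T : RootData U ι β)

/-- The number of members outside the blocks in `K` that miss `S`. -/
def dem (K : Finset β) (S : Finset U) : ℤ :=
  ∑ i, if T.block i ∉ K ∧ Disjoint S (T.R i) then 1 else 0

/-- The number of members in the blocks of `K` that miss `v`. -/
def cap (K : Finset β) (v : U) : ℤ :=
  ∑ i, if T.block i ∈ K ∧ v ∉ T.R i then 1 else 0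

/-- The number of free arcs entering `S` that the blocks outside `K` can spare. -/
def spare (K : Finset β) (S : Finset U) : ℤ := T.d S - T.dem K S

/-- The number of free root arcs to `v` that the blocks in `K` can use. -/
def wt (K : Finset β) (v : U) : ℤ := min (T.cap K v) (T.n v)

/-- The bound that the packing `X` gives for the number of root arcs used by the blocks in `K`. -/
def val (K : Finset β) (X : Finset (Finset U)) : ℤ :=
  ∑ S ∈ X, T.spare K S + ∑ v ∈ T.V \ X.biUnion id, T.wt K v

/-- All the bounds are at least the demands. -/
def Feasible : Prop :=
  ∀ K X, IsPacking X → X.biUnion id ⊆ T.V → ∑ a ∈ K, T.c a ≤ T.val K X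

/-- The properties of the arc counts that are used. -/
structure Valid : Prop where
  n_nonneg : ∀ v, 0 ≤ T.n v
  n_le : ∀ S, S ⊆ T.V → ∑ v ∈ S, T.n v ≤ T.d S
  submod : ∀ S S', T.d (S ∪ S') + T.d (S ∩ S') ≤ T.d S + T.d S'

/-- The packing `X` attains the bound for `K`. -/
def Tight (K : Finset β) (X : Finset (Finset U)) : Prop :=
  IsPacking X ∧ X.biUnion id ⊆ T.V ∧ T.val K X ≤ ∑ a ∈ K, T.c a

/-- Some tight packing for `K` forces all free root arcs to `u` to be used by blocks in `K`. -/
def Exhausted (u : U) (K : Finset β) : Prop :=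
  ∃ X, T.Tight K X ∧ u ∉ X.biUnion id ∧ T.n u ≤ T.cap K u

variable {T}

/-- A higher level has fewer members left to serve. For submodularity, a member counted for `S` at
`K` or for `S'` at `L` is counted for `S ∩ S'` at `K ∩ L`, and one counted twice is also counted for
`S ∪ S'` at `K ∪ L`. -/
theorem spare_leveledSubmodular (hT : T.Valid) : LeveledSubmodular T.spare where
  mono := by
    intro K L S h
    unfold spare dem
    refine sub_le_sub_left (Finset.sum_le_sum fun i _ => ?_) _
    have := @h (T.block i)
    split_ifs <;> simp_all
  submod := by
    intro K L S S' _
    have h := hT.submod S S'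
    have key : T.dem K S + T.dem L S' ≤ T.dem (K ∪ L) (S ∪ S') + T.dem (K ∩ L) (S ∩ S') := by
      unfold dem
      rw [← Finset.sum_add_distrib, ← Finset.sum_add_distrib]
      refine Finset.sum_le_sum fun i _ => ?_
      have e1 : Disjoint S (T.R i) → Disjoint (S ∩ S') (T.R i) :=
        fun h => h.mono_left Finset.inter_subset_left
      have e2 : Disjoint S' (T.R i) → Disjoint (S ∩ S') (T.R i) :=
        fun h => h.mono_left Finset.inter_subset_right
      simp only [Finset.disjoint_union_left, Finset.mem_union, Finset.mem_inter]
      by_cases a1 : T.block i ∈ K <;> by_cases a2 : T.block i ∈ L <;>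
        by_cases a3 : Disjoint S (T.R i) <;> by_cases a4 : Disjoint S' (T.R i) <;>
        by_cases a5 : Disjoint (S ∩ S') (T.R i) <;> simp_all
    unfold spare
    linarith

theorem cap_union_add_cap_inter (K L : Finset β) (v : U) :
    T.cap (K ∪ L) v + T.cap (K ∩ L) v = T.cap K v + T.cap L v := by
  unfold cap
  rw [← Finset.sum_add_distrib, ← Finset.sum_add_distrib]
  refine Finset.sum_congr rfl fun i _ => ?_
  simp only [Finset.mem_union, Finset.mem_inter]
  by_cases a1 : T.block i ∈ K <;> by_cases a2 : T.block i ∈ L <;>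
    by_cases a3 : v ∈ T.R i <;> simp [*]

theorem cap_mono {K L : Finset β} (h : K ⊆ L) (v : U) : T.cap K v ≤ T.cap L v := by
  unfold cap
  refine Finset.sum_le_sum fun i _ => ?_
  have := @h (T.block i)
  split_ifs <;> simp_all

/-- A member that stops counting against `S` when `K` grows to `K ∪ L` lies in a block of `L`
outside `K` and misses `v`. It thus accounts for one unit of the drop in capacity at `v` from `L` to
`K ∩ L`. -/
theorem spare_union_le {K L : Finset β} {S : Finset U} {v : U} (hv : v ∈ S) :
    T.spare (K ∪ L) S + T.cap (K ∩ L) v ≤ T.spare K S + T.cap L v := by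
  have : T.dem K S + T.cap (K ∩ L) v ≤ T.dem (K ∪ L) S + T.cap L v := by
    unfold dem cap
    rw [← Finset.sum_add_distrib, ← Finset.sum_add_distrib]
    refine Finset.sum_le_sum fun i _ => ?_
    have e : Disjoint S (T.R i) → v ∉ T.R i := fun h => Finset.disjoint_left.mp h hv
    simp only [Finset.mem_union, Finset.mem_inter]
    by_cases a1 : T.block i ∈ K <;> by_cases a2 : T.block i ∈ L <;>
      by_cases a3 : Disjoint S (T.R i) <;> by_cases a4 : v ∈ T.R i <;> simp_all
  unfold spare
  linarith

/-- Uncrossing two packings for the blocks in `K` and `L`; if possible, the weight of `u` may be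
lowered by `e` for the first of them. -/
theorem val_uncross (hT : T.Valid) {K L : Finset β} {X X' : Finset (Finset U)}
    (hX : IsPacking X) (hX' : IsPacking X') (hXV : X.biUnion id ⊆ T.V)
    (hXV' : X'.biUnion id ⊆ T.V) (u : U) (e : ℤ)
    (he : e = 0 ∨ (u ∉ X.biUnion id ∧ T.wt (K ∩ L) u + e ≤ T.wt K u ∧ T.n u ≤ T.cap K u ∧
      (u ∉ X'.biUnion id → T.n u ≤ T.cap L u) ∧
      ∀ S ∈ X', u ∈ S → Disjoint S (X.biUnion id) → ∃ v ∈ S, T.cap K v < T.n v)) :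
    ∃ Y Y' : Finset (Finset U), IsPacking Y ∧ IsPacking Y' ∧
      Y.biUnion id ⊆ T.V ∧ Y'.biUnion id ⊆ T.V ∧
      (∀ S ∈ X, ¬ Disjoint S (X'.biUnion id) → ∃ Z ∈ Y, S ⊆ Z) ∧
      (∀ S ∈ X', ¬ Disjoint S (X.biUnion id) → ∃ Z ∈ Y, S ⊆ Z) ∧
      (∀ S ∈ X', Disjoint S (X.biUnion id) → (∀ v ∈ S, T.n v ≤ T.cap K v) → S ∈ Y') ∧
      (∀ v ∈ Y'.biUnion id, v ∈ X.biUnion id ∨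
        ∃ S ∈ X', Disjoint S (X.biUnion id) ∧ (∀ v ∈ S, T.n v ≤ T.cap K v) ∧ v ∈ S) ∧
      T.val (K ∪ L) Y + T.val (K ∩ L) Y' ≤
        ∑ S ∈ X, T.spare K S +
          ∑ v ∈ T.V \ X.biUnion id, (T.wt K v - if v = u then e else 0) + T.val L X' := by
  classical
  have hnot : ∀ S ∈ X', Disjoint S (X.biUnion id) → S ∉ X := by
    intro S hS hd hSX
    obtain ⟨v, hv⟩ := hX'.1 S hS
    exact Finset.disjoint_left.mp hd hv (Finset.mem_biUnion.mpr ⟨S, hSX, hv⟩)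
  have hc : ∀ v, T.wt (K ∩ L) v ≤ T.wt K v := fun v =>
    min_le_min_right _ (cap_mono Finset.inter_subset_left v)
  have hc' : ∀ v, T.wt (K ∩ L) v ≤ T.wt L v := fun v =>
    min_le_min_right _ (cap_mono Finset.inter_subset_right v)
  have h41 : ∀ v, T.wt (K ∩ L) v ≤ T.wt K v - if v = u then e else 0 := by
    intro v
    split_ifs with h
    · subst h
      rcases he with rfl | ⟨-, h, -⟩
      · simpa using hc v
      · linarith
    · simpa using hc v
  have hlt : ∀ {v}, T.cap K v < T.n v → (if v = u then e else 0) = 0 := by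
    intro v hv
    split_ifs with h
    · subst h
      rcases he with rfl | ⟨-, -, h, -⟩
      · rfl
      · exact absurd h (not_le.mpr hv)
    · rfl
  have hu : ∀ S ∈ X', Disjoint S (X.biUnion id) → (∀ v ∈ S, T.n v ≤ T.cap K v) →
      ∀ v ∈ S, (if v = u then e else 0) = 0 := by
    intro S hS hd hle v hv
    split_ifs with h
    · subst h
      rcases he with rfl | ⟨-, -, -, -, h⟩
      · rfl
      · obtain ⟨w, hw, hlt⟩ := h S hS hv hd
        exact absurd (hle w hw) (not_le.mpr hlt)
    · rfl
  -- Where the criterion holds at `v`, the weight at the other level is its capacity, and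
  -- `spare_union_le` pays for moving up. Where it fails, the weight at the other level is `n` on
  -- the whole set, which bounds the weight at `K ∪ L`.
  refine Exists.elim ((spare_leveledSubmodular hT).uncross T.V K L hX hX' hXV hXV'
      (fun v => T.wt K v - if v = u then e else 0) (T.wt L) (T.wt (K ∪ L)) (T.wt (K ∩ L))
      (fun S => ∃ v ∈ S, (if S ∈ X then T.cap L v else T.cap K v) < T.n v) ?_
      (fun v _ _ => h41 v) (fun v _ _ => hc' v) ?_ ?_ ?_ ?_) ?_
  · intro v hv hv'
    have hm := cap_union_add_cap_inter (T := T) K L v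
    have h1 := cap_mono (T := T) (Finset.inter_subset_left : K ∩ L ⊆ K) v
    have h2 := cap_mono (T := T) (Finset.inter_subset_right : K ∩ L ⊆ L) v
    -- Truncating the modular monotone function `cap` at the constant `n v` leaves it submodular in
    -- the level.
    have main : T.wt (K ∪ L) v + T.wt (K ∩ L) v ≤ T.wt K v + T.wt L v := by
      unfold wt
      rcases min_cases (T.cap K v) (T.n v) with ⟨e1, _⟩ | ⟨e1, _⟩ <;>
        rcases min_cases (T.cap L v) (T.n v) with ⟨e2, _⟩ | ⟨e2, _⟩ <;>
        rw [e1, e2] <;>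
        linarith [min_le_left (T.cap (K ∪ L) v) (T.n v), min_le_right (T.cap (K ∪ L) v) (T.n v),
          min_le_left (T.cap (K ∩ L) v) (T.n v), min_le_right (T.cap (K ∩ L) v) (T.n v)]
    split_ifs with h
    · subst h
      rcases he with rfl | ⟨-, h3, -, h4, -⟩
      · simpa using main
      -- The weight at `L` is `n v`, which pays for level `K ∪ L`; the gap between the weights at
      -- `K` and `K ∩ L` pays for `e`.
      · have : T.wt L v = T.n v := min_eq_right (h4 hv')
        have := min_le_right (T.cap (K ∪ L) v) (T.n v)
        unfold wt at *
        linarith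
    · simpa using main
  · rintro S hS - ⟨v, hv, hlt⟩
    rw [if_pos hS] at hlt
    rw [← Finset.add_sum_erase S _ hv, ← Finset.add_sum_erase S _ hv]
    have h1 : T.wt L v = T.cap L v := min_eq_left hlt.le
    have h2 : T.wt (K ∩ L) v ≤ T.cap (K ∩ L) v := min_le_left _ _
    have h3 := Finset.sum_le_sum fun w (_ : w ∈ S.erase v) => hc' w
    have h4 := spare_union_le (T := T) (K := K) (L := L) hv
    linarith
  · rintro S hS hd ⟨v, hv, hlt'⟩
    rw [if_neg (hnot S hS hd)] at hlt'
    rw [← Finset.add_sum_erase S _ hv, ← Finset.add_sum_erase S _ hv, hlt hlt']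
    have h1 : T.wt K v = T.cap K v := min_eq_left hlt'.le
    have h2 : T.wt (K ∩ L) v ≤ T.cap (K ∩ L) v := min_le_left _ _
    have h3 := Finset.sum_le_sum fun w (_ : w ∈ S.erase v) => h41 w
    have h4 := spare_union_le (T := T) (K := L) (L := K) hv
    rw [Finset.union_comm, Finset.inter_comm] at h4
    linarith
  · intro S hS _ hg v hv
    have : T.n v ≤ T.cap L v := by
      by_contra h
      exact hg ⟨v, hv, by rw [if_pos hS]; exact not_le.mp h⟩
    rw [show T.wt L v = T.n v from min_eq_right this]
    exact min_le_right _ _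
  · intro S hS hd hg v hv
    have hall : ∀ v ∈ S, T.n v ≤ T.cap K v := by
      intro v hv
      by_contra h
      exact hg ⟨v, hv, by rw [if_neg (hnot S hS hd)]; exact not_le.mp h⟩
    rw [hu S hS hd hall v hv, show T.wt K v = T.n v from min_eq_right (hall v hv), sub_zero]
    exact min_le_right _ _
  · rintro Y ⟨Y', hY, hY', hYV, hYV', r1, r2, r3, r4, hle⟩
    refine ⟨Y, Y', hY, hY', hYV, hYV', r1, r2, ?_, ?_, hle⟩
    · intro S hS hd hle
      refine r3 S hS hd ?_
      rintro ⟨v, hv, hlt⟩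
      rw [if_neg (hnot S hS hd)] at hlt
      exact absurd (hle v hv) (not_le.mpr hlt)
    · intro v hv
      refine (r4 v hv).imp_right ?_
      rintro ⟨S, hS, hd, hg, hvS⟩
      refine ⟨S, hS, hd, fun w hw => ?_, hvS⟩
      by_contra hlt
      exact hg ⟨w, hw, by rw [if_neg (hnot S hS hd)]; exact not_le.mp hlt⟩

/-- The total demand is modular in the level, so the two lower bounds from feasibility leave no
slack in either packing. -/
theorem Feasible.tight_of_add_le (hF : T.Feasible) {K L : Finset β} {Y Y' : Finset (Finset U)}
    (hY : IsPacking Y) (hY' : IsPacking Y') (hYV : Y.biUnion id ⊆ T.V)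
    (hYV' : Y'.biUnion id ⊆ T.V)
    (h : T.val (K ∪ L) Y + T.val (K ∩ L) Y' ≤ ∑ a ∈ K, T.c a + ∑ a ∈ L, T.c a) :
    T.Tight (K ∪ L) Y ∧ T.Tight (K ∩ L) Y' := by
  have h1 := hF (K ∪ L) Y hY hYV
  have h2 := hF (K ∩ L) Y' hY' hYV'
  have h3 := Finset.sum_union_inter (s₁ := K) (s₂ := L) (f := T.c)
  exact ⟨⟨hY, hYV, by linarith⟩, ⟨hY', hYV', by linarith⟩⟩

/-- Both sets contain `u`, so each is swallowed by a member of the upper packing, and by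
disjointness it is the same member. -/
theorem Tight.union (hF : T.Feasible) (hT : T.Valid) {K L : Finset β}
    {X X' : Finset (Finset U)} (h : T.Tight K X) (h' : T.Tight L X') {u : U} {S S' : Finset U}
    (hS : S ∈ X) (hS' : S' ∈ X') (hu : u ∈ S) (hu' : u ∈ S') :
    ∃ Y, T.Tight (K ∪ L) Y ∧ ∃ Z ∈ Y, S ∪ S' ⊆ Z := by
  obtain ⟨Y, Y', hY, hY', hYV, hYV', r1, r2, -, -, hle⟩ :=
    val_uncross hT (K := K) (L := L) h.1 h'.1 h.2.1 h'.2.1 u 0 (Or.inl rfl)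
  have ht := hF.tight_of_add_le hY hY' hYV hYV' (by
    have h1 := h.2.2
    have h2 := h'.2.2
    simp only [ite_self, sub_zero] at hle
    exact hle.trans (add_le_add h1 h2))
  obtain ⟨Z, hZ, hSZ⟩ := r1 S hS (Finset.not_disjoint_iff.mpr
    ⟨u, hu, Finset.mem_biUnion.mpr ⟨S', hS', hu'⟩⟩)
  obtain ⟨Z', hZ', hSZ'⟩ := r2 S' hS' (Finset.not_disjoint_iff.mpr
    ⟨u, hu', Finset.mem_biUnion.mpr ⟨S, hS, hu⟩⟩)
  obtain rfl := hY.eq_of_mem hZ hZ' (hSZ hu) (hSZ' hu')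
  exact ⟨Y, ht.1, Z, hZ, Finset.union_subset hSZ hSZ'⟩

/-- Exhaustion at `u` passes to the intersection of the levels unless a set of `X'` through `u`,
disjoint from `X`, is handed down unchanged. This exception is what later supplies a covering set at
the lower level. -/
theorem Tight.inter (hF : T.Feasible) (hT : T.Valid) {K L : Finset β}
    {X X' : Finset (Finset U)} (h : T.Tight K X) (h' : T.Tight L X') {u : U}
    (huV : u ∈ T.V) (hu : u ∉ X.biUnion id) (hn : T.n u ≤ T.cap K u)
    (hu' : u ∉ X'.biUnion id → T.n u ≤ T.cap L u) :
    T.Exhausted u (K ∩ L) ∨ ∃ S ∈ X', u ∈ S ∧ Disjoint S (X.biUnion id) ∧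
      (∀ v ∈ S, T.n v ≤ T.cap K v) ∧ ∃ Y, T.Tight (K ∩ L) Y ∧ S ∈ Y := by
  have h1 := h.2.2
  have h2 := h'.2.2
  obtain ⟨Y, Y', hY, hY', hYV, hYV', -, -, r3, r4, hle⟩ :=
    val_uncross hT (K := K) (L := L) h.1 h'.1 h.2.1 h'.2.1 u 0 (Or.inl rfl)
  have ht := hF.tight_of_add_le hY hY' hYV hYV' (by
    simp only [ite_self, sub_zero] at hle
    exact hle.trans (add_le_add h1 h2))
  by_cases hS : ∃ S ∈ X', u ∈ S ∧ Disjoint S (X.biUnion id) ∧ ∀ v ∈ S, T.n v ≤ T.cap K v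
  · obtain ⟨S, hS, huS, hd, hle⟩ := hS
    exact Or.inr ⟨S, hS, huS, hd, hle, Y', ht.2, r3 S hS hd hle⟩
  left
  have hSn : ∀ S ∈ X', u ∈ S → Disjoint S (X.biUnion id) → ∃ v ∈ S, T.cap K v < T.n v := by
    intro S hS' huS hd
    by_contra hcon
    push Not at hcon
    exact hS ⟨S, hS', huS, hd, hcon⟩
  refine ⟨Y', ht.2, fun hmem => ?_, ?_⟩
  · rcases r4 u hmem with hh | ⟨S, hS', hd, hle, huS⟩
    · exact hu hh
    · exact hS ⟨S, hS', huS, hd, hle⟩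
  by_contra hlt
  push Not at hlt
  have e1 : T.wt K u = T.n u := min_eq_right hn
  have e2 : T.wt (K ∩ L) u = T.cap (K ∩ L) u := min_eq_left hlt.le
  -- If `K ∩ L` could not use all arcs to `u`, its weight at `u` would be smaller than that of `K`;
  -- uncrossing would then still work with the weight at `K` lowered by one, and the total would
  -- drop below the demands.
  obtain ⟨Z, Z', hZ, hZ', hZV, hZV', -, -, -, -, hle⟩ :=
    val_uncross hT (K := K) (L := L) h.1 h'.1 h.2.1 h'.2.1 u 1
      (Or.inr ⟨hu, by rw [e1, e2]; linarith, hn, hu', hSn⟩)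
  have f1 := hF (K ∪ L) Z hZ hZV
  have f2 := hF (K ∩ L) Z' hZ' hZV'
  have f3 := Finset.sum_union_inter (s₁ := K) (s₂ := L) (f := T.c)
  rw [Finset.sum_sub_distrib, Finset.sum_ite_eq'] at hle
  rw [if_pos (Finset.mem_sdiff.mpr ⟨huV, hu⟩)] at hle
  have f4 : T.val K X = ∑ S ∈ X, T.spare K S + ∑ v ∈ T.V \ X.biUnion id, T.wt K v := rfl
  linarith

end RootData

/-! ### Handing out one root arc. -/

namespace RootData

variable {U ι β : Type*} [DecidableEq U] [DecidableEq β] [Fintype ι] [DecidableEq ι]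
  (T : RootData U ι β)

/-- The data after a free root arc to `u` has been added to the member with index `i`. -/
def addRoot (u : U) (i : ι) : RootData U ι β where
  V := T.V
  block := T.block
  R := Function.update T.R i (insert u (T.R i))
  d S := T.d S - if u ∈ S then 1 else 0
  n v := T.n v - if v = u then 1 else 0
  c a := T.c a - if a = T.block i then 1 else 0

variable {T}

theorem dem_addRoot (u : U) (i : ι) (K : Finset β) (S : Finset U) :
    (T.addRoot u i).dem K S =
      T.dem K S - if T.block i ∉ K ∧ Disjoint S (T.R i) ∧ u ∈ S then 1 else 0 := by
  rw [eq_sub_iff_add_eq]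
  unfold dem
  rw [← Finset.add_sum_erase _ _ (Finset.mem_univ i), ← Finset.add_sum_erase _ _ (Finset.mem_univ i)]
  have h : ∀ j ∈ Finset.univ.erase i, (if (T.addRoot u i).block j ∉ K ∧
      Disjoint S ((T.addRoot u i).R j) then (1 : ℤ) else 0) =
      if T.block j ∉ K ∧ Disjoint S (T.R j) then 1 else 0 := by
    intro j hj
    simp only [addRoot, Function.update_of_ne (Finset.ne_of_mem_erase hj)]
  rw [Finset.sum_congr rfl h]
  simp only [addRoot, Function.update_self, Finset.disjoint_insert_right]
  by_cases a1 : T.block i ∈ K <;> by_cases a2 : u ∈ S <;>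
    by_cases a3 : Disjoint S (T.R i) <;> simp [*] <;> ring

theorem cap_addRoot_self {u : U} {i : ι} (hu : u ∉ T.R i) (K : Finset β) :
    (T.addRoot u i).cap K u = T.cap K u - if T.block i ∈ K then 1 else 0 := by
  rw [eq_sub_iff_add_eq]
  unfold cap
  rw [← Finset.add_sum_erase _ _ (Finset.mem_univ i), ← Finset.add_sum_erase _ _ (Finset.mem_univ i)]
  have h : ∀ j ∈ Finset.univ.erase i, (if (T.addRoot u i).block j ∈ K ∧
      u ∉ (T.addRoot u i).R j then (1 : ℤ) else 0) =
      if T.block j ∈ K ∧ u ∉ T.R j then 1 else 0 := by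
    intro j hj
    simp only [addRoot, Function.update_of_ne (Finset.ne_of_mem_erase hj)]
  rw [Finset.sum_congr rfl h]
  simp only [addRoot, Function.update_self]
  by_cases a1 : T.block i ∈ K <;> simp [*] <;> ring

theorem cap_addRoot_of_ne {u v : U} (i : ι) (hv : v ≠ u) (K : Finset β) :
    (T.addRoot u i).cap K v = T.cap K v := by
  unfold cap
  refine Finset.sum_congr rfl fun j _ => ?_
  by_cases hj : j = i
  · subst hj
    simp [addRoot, hv]
  · simp [addRoot, Function.update_of_ne hj]

theorem wt_addRoot_of_ne {u v : U} (i : ι) (hv : v ≠ u) (K : Finset β) :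
    (T.addRoot u i).wt K v = T.wt K v := by
  unfold wt
  rw [cap_addRoot_of_ne i hv]
  simp [addRoot, hv]

theorem spare_addRoot_of_notMem {u : U} (i : ι) {S : Finset U} (hu : u ∉ S) (K : Finset β) :
    (T.addRoot u i).spare K S = T.spare K S := by
  unfold spare
  rw [dem_addRoot]
  simp [addRoot, hu]

theorem spare_addRoot_of_mem {u : U} (i : ι) {S : Finset U} (hu : u ∈ S) (K : Finset β) :
    (T.addRoot u i).spare K S =
      T.spare K S - 1 + if T.block i ∉ K ∧ Disjoint S (T.R i) then 1 else 0 := by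
  unfold spare
  rw [dem_addRoot]
  simp only [addRoot, hu, and_true, if_true]
  ring

theorem wt_addRoot_self {u : U} {i : ι} (hu : u ∉ T.R i) (K : Finset β) :
    T.wt K u - 1 ≤ (T.addRoot u i).wt K u := by
  have h : (T.addRoot u i).n u = T.n u - 1 := by simp [addRoot]
  unfold wt
  rw [cap_addRoot_self hu, h]
  split_ifs <;> grind

/-- The minimum is the capacity, which a member outside `K` does not affect; the strict inequality
leaves room for one arc to disappear. -/
theorem wt_addRoot_self_eq {u : U} {i : ι} (hu : u ∉ T.R i) {K : Finset β}
    (hi : T.block i ∉ K) (hn : T.cap K u < T.n u) : (T.addRoot u i).wt K u = T.wt K u := by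
  have h : (T.addRoot u i).n u = T.n u - 1 := by simp [addRoot]
  unfold wt
  rw [cap_addRoot_self hu, h, if_neg hi, sub_zero, min_eq_left hn.le, min_eq_left (by omega)]

theorem val_addRoot_of_mem {u : U} (i : ι) {K : Finset β} {X : Finset (Finset U)}
    (hX : IsPacking X) {S : Finset U} (hS : S ∈ X) (hu : u ∈ S) :
    (T.addRoot u i).val K X = T.val K X - T.spare K S + (T.addRoot u i).spare K S := by
  unfold val
  rw [← Finset.add_sum_erase X _ hS, ← Finset.add_sum_erase X _ hS]
  have h1 : ∑ S' ∈ X.erase S, (T.addRoot u i).spare K S' = ∑ S' ∈ X.erase S, T.spare K S' :=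
    Finset.sum_congr rfl fun S' hS' => spare_addRoot_of_notMem i (fun hu' =>
      Finset.ne_of_mem_erase hS' (hX.eq_of_mem (Finset.mem_of_mem_erase hS') hS hu' hu)) K
  have h2 : ∑ v ∈ (T.addRoot u i).V \ X.biUnion id, (T.addRoot u i).wt K v =
      ∑ v ∈ T.V \ X.biUnion id, T.wt K v := by
    refine Finset.sum_congr rfl fun v hv => wt_addRoot_of_ne i ?_ K
    rintro rfl
    exact (Finset.mem_sdiff.mp hv).2 (Finset.mem_biUnion.mpr ⟨S, hS, hu⟩)
  rw [h1, h2]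
  ring

theorem val_addRoot_of_notMem {u : U} (i : ι) {K : Finset β} {X : Finset (Finset U)}
    (hV : u ∈ T.V) (hu : u ∉ X.biUnion id) :
    (T.addRoot u i).val K X = T.val K X - T.wt K u + (T.addRoot u i).wt K u := by
  unfold val
  have h1 : ∑ S' ∈ X, (T.addRoot u i).spare K S' = ∑ S' ∈ X, T.spare K S' :=
    Finset.sum_congr rfl fun S' hS' => spare_addRoot_of_notMem i (fun hu' =>
      hu (Finset.mem_biUnion.mpr ⟨S', hS', hu'⟩)) K
  have hmem : u ∈ T.V \ X.biUnion id := Finset.mem_sdiff.mpr ⟨hV, hu⟩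
  have h2 : ∑ v ∈ (T.addRoot u i).V \ X.biUnion id, (T.addRoot u i).wt K v =
      ∑ v ∈ T.V \ X.biUnion id, (T.addRoot u i).wt K v := rfl
  rw [h1, h2, ← Finset.add_sum_erase _ _ hmem, ← Finset.add_sum_erase _ _ hmem]
  have h3 : ∑ v ∈ (T.V \ X.biUnion id).erase u, (T.addRoot u i).wt K v =
      ∑ v ∈ (T.V \ X.biUnion id).erase u, T.wt K v :=
    Finset.sum_congr rfl fun v hv => wt_addRoot_of_ne i (Finset.ne_of_mem_erase hv) K
  rw [h3]
  ring

/-- The obstruction to adding a root arc to `u` to the member with index `i`. -/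
theorem Feasible.exists_tight_of_not_feasible_addRoot (hF : T.Feasible) {u : U} {i : ι}
    (hV : u ∈ T.V) (hu : u ∉ T.R i) (h : ¬ (T.addRoot u i).Feasible) :
    ∃ K X, T.Tight K X ∧ T.block i ∉ K ∧
      ((u ∉ X.biUnion id ∧ T.n u ≤ T.cap K u) ∨ ∃ S ∈ X, u ∈ S ∧ ¬ Disjoint S (T.R i)) := by
  unfold Feasible at h
  push Not at h
  obtain ⟨K, X, hX, hXV, hlt⟩ := h
  -- The slack is an integer and drops by at most one, so a bound violated afterwards was tight
  -- before. If the block of `i` lies in `K`, the demand drops as well and nothing is violated.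
  have hF' := hF K X hX hXV
  have hc : ∑ a ∈ K, (T.addRoot u i).c a =
      ∑ a ∈ K, T.c a - if T.block i ∈ K then 1 else 0 := by
    simp only [addRoot, Finset.sum_sub_distrib, Finset.sum_ite_eq']
  rw [hc] at hlt
  by_cases hmem : u ∈ X.biUnion id
  · obtain ⟨S, hS, huS⟩ := Finset.mem_biUnion.mp hmem
    rw [id] at huS
    rw [val_addRoot_of_mem i hX hS huS, spare_addRoot_of_mem i huS] at hlt
    by_cases hi : T.block i ∈ K
    · simp only [hi, not_true_eq_false, false_and, if_true, if_false] at hlt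
      omega
    · by_cases hd : Disjoint S (T.R i)
      · simp only [hi, hd, not_false_eq_true, true_and, if_true, if_false] at hlt
        omega
      · simp only [hi, hd, not_false_eq_true, and_false, if_false] at hlt
        exact ⟨K, X, ⟨hX, hXV, by omega⟩, hi, Or.inr ⟨S, hS, huS, hd⟩⟩
  · rw [val_addRoot_of_notMem i hV hmem] at hlt
    have h1 := wt_addRoot_self hu K
    by_cases hi : T.block i ∈ K
    · simp only [hi, if_true] at hlt
      omega
    · simp only [hi, if_false] at hlt
      refine ⟨K, X, ⟨hX, hXV, by omega⟩, hi, Or.inl ⟨hmem, ?_⟩⟩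
      by_contra hn
      rw [wt_addRoot_self_eq hu hi (not_le.mp hn)] at hlt
      omega

/-- As long as a free root arc to `u` can be used by some member, one of these members may take it
without violating feasibility. -/
theorem Feasible.exists_addRoot [Fintype β] (hF : T.Feasible) (hT : T.Valid) {u : U}
    (hV : u ∈ T.V) (hn : 0 < T.n u) (hR : ∃ i, u ∉ T.R i) :
    ∃ i, u ∉ T.R i ∧ (T.addRoot u i).Feasible := by
  classical
  by_contra hcon
  push Not at hcon
  have bad := fun i (hi : u ∉ T.R i) =>
    hF.exists_tight_of_not_feasible_addRoot hV hi (hcon i hi)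
  -- a minimal level that exhausts the arcs to `u`
  let E : Finset (Finset β) := Finset.univ.filter fun K => K = Finset.univ ∨ T.Exhausted u K
  obtain ⟨K₀, hK₀, hmin⟩ := E.exists_minimal ⟨Finset.univ, by simp [E]⟩
  have hK₀ : K₀ = Finset.univ ∨ T.Exhausted u K₀ := (Finset.mem_filter.mp hK₀).2
  have hmin : ∀ K, K ⊆ K₀ → T.Exhausted u K → K = K₀ := fun K hK h =>
    Finset.Subset.antisymm hK (hmin (Finset.mem_filter.mpr ⟨Finset.mem_univ _, Or.inr h⟩) hK)
  -- By minimality `K₀ ∩ K` cannot exhaust `u`, since it lacks the block of `i`. Intersecting with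
  -- the packing for `K₀` hence hands the set covering `u` down to a level inside `K₀`.
  have hcover : ∀ i, u ∉ T.R i → T.block i ∈ K₀ → ∃ K X S, K ⊆ K₀ ∧ T.block i ∉ K ∧
      T.Tight K X ∧ S ∈ X ∧ u ∈ S ∧ ¬ Disjoint S (T.R i) := by
    intro i hi hiK
    obtain ⟨K, X, ht, hiK', hcase⟩ := bad i hi
    have hne : ¬ T.Exhausted u (K₀ ∩ K) := fun h =>
      hiK' ((Finset.mem_inter.mp ((hmin _ Finset.inter_subset_left h).symm ▸ hiK)).2)
    rcases hK₀ with rfl | ⟨X₀, ht₀, hu₀, hn₀⟩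
    · rw [Finset.univ_inter] at hne
      rcases hcase with ⟨h1, h2⟩ | ⟨S, hS, huS, hd⟩
      · exact absurd ⟨X, ht, h1, h2⟩ hne
      · exact ⟨K, X, S, Finset.subset_univ _, hiK', ht, hS, huS, hd⟩
    · rcases ht₀.inter hF hT ht hV hu₀ hn₀ (fun h => by
        rcases hcase with h' | ⟨S, hS, huS, -⟩
        · exact h'.2
        · exact absurd (Finset.mem_biUnion.mpr ⟨S, hS, huS⟩) h) with h | ⟨S, hS, huS, -, -, Y, hY, hSY⟩
      · exact absurd h hne
      · rcases hcase with h' | ⟨S', hS', huS', hd⟩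
        · exact absurd (Finset.mem_biUnion.mpr ⟨S, hS, huS⟩) h'.1
        · obtain rfl := ht.1.eq_of_mem hS hS' huS huS'
          exact ⟨K₀ ∩ K, Y, S, Finset.inter_subset_left,
            fun h => hiK' (Finset.mem_inter.mp h).2, hY, hSY, huS, hd⟩
  have hex : ∃ i, u ∉ T.R i ∧ T.block i ∈ K₀ := by
    rcases hK₀ with rfl | ⟨-, -, -, hn₀⟩
    · obtain ⟨i, hi⟩ := hR
      exact ⟨i, hi, Finset.mem_univ _⟩
    · by_contra h
      push Not at h
      have : T.cap K₀ u = 0 := Finset.sum_eq_zero fun i _ => if_neg fun hi => h i hi.2 hi.1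
      omega
  -- a maximal smaller level at which a tight packing covers `u`
  let C : Finset (Finset β) := Finset.univ.filter fun K =>
    K ⊂ K₀ ∧ ∃ X, T.Tight K X ∧ ∃ S ∈ X, u ∈ S
  have hC : C.Nonempty := by
    obtain ⟨i, hi, hiK⟩ := hex
    obtain ⟨K, X, S, hK, hiK', ht, hS, huS, -⟩ := hcover i hi hiK
    exact ⟨K, Finset.mem_filter.mpr ⟨Finset.mem_univ _,
      Finset.ssubset_iff_subset_ne.mpr ⟨hK, fun h => hiK' (h ▸ hiK)⟩, X, ht, S, hS, huS⟩⟩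
  obtain ⟨K₁, hK₁, hmax⟩ := C.exists_maximal hC
  obtain ⟨-, hK₁₀, hX₁⟩ := Finset.mem_filter.mp hK₁
  have hfin : (T.V.powerset.filter fun S => u ∈ S ∧ ∃ X, T.Tight K₁ X ∧ S ∈ X).Nonempty := by
    obtain ⟨X, ht, S, hS, huS⟩ := hX₁
    exact ⟨S, Finset.mem_filter.mpr ⟨Finset.mem_powerset.mpr
      ((Finset.subset_biUnion_of_mem id hS).trans ht.2.1), huS, X, ht, hS⟩⟩
  obtain ⟨S, hSmem, hSmax⟩ := Finset.exists_maximal hfin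
  obtain ⟨hSV, huS, X, ht, hS⟩ := Finset.mem_filter.mp hSmem
  rw [Finset.mem_powerset] at hSV
  have hnot : ¬ T.Exhausted u K₁ := fun h => hK₁₀.ne (hmin K₁ hK₁₀.subset h)
  -- Merging `S` with the obstruction for `i` stays at a proper part of `K₀`, because neither level
  -- contains the block of `i`. Maximality of `K₁` and then of `S` makes `S` contain the set of the
  -- obstruction, which meets `R i`.
  have hmeet : ∀ i, T.block i ∈ K₀ → T.block i ∉ K₁ → ¬ Disjoint S (T.R i) := by
    intro i hi hi'
    by_cases hui : u ∈ T.R i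
    · exact Finset.not_disjoint_iff.mpr ⟨u, huS, hui⟩
    obtain ⟨K, X', S', hK, hiK, ht', hS', huS', hd⟩ := hcover i hui hi
    obtain ⟨Y, hY, Z, hZ, hsub⟩ := ht.union hF hT ht' hS hS' huS huS'
    have huZ : u ∈ Z := hsub (Finset.mem_union_left _ huS)
    have hK' : K₁ ∪ K = K₁ := by
      refine Finset.Subset.antisymm (hmax ?_ Finset.subset_union_left) Finset.subset_union_left
      refine Finset.mem_filter.mpr ⟨Finset.mem_univ _, Finset.ssubset_iff_subset_ne.mpr
        ⟨Finset.union_subset hK₁₀.subset hK, fun h => ?_⟩, Y, hY, Z, hZ, huZ⟩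
      rw [← h, Finset.mem_union] at hi
      exact hi.elim hi' hiK
    rw [hK'] at hY
    have hZS : Z ⊆ S := hSmax (Finset.mem_filter.mpr ⟨Finset.mem_powerset.mpr
      ((Finset.subset_biUnion_of_mem id hZ).trans hY.2.1), huZ, Y, hY, hZ⟩)
      (Finset.subset_union_left.trans hsub)
    exact fun h => hd (h.mono_left ((Finset.subset_union_right.trans hsub).trans hZS))
  have hspare : T.spare K₁ S = T.spare K₀ S := by
    unfold spare dem
    congr 1
    refine Finset.sum_congr rfl fun i _ => ?_
    have : T.block i ∉ K₁ ∧ Disjoint S (T.R i) ↔ T.block i ∉ K₀ ∧ Disjoint S (T.R i) :=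
      ⟨fun h => ⟨fun h0 => hmeet i h0 h.1 h.2, h.2⟩, fun h => ⟨fun h' => h.1 (hK₁₀.subset h'), h.2⟩⟩
    simp only [this]
  -- At the level of all blocks no member makes a demand on `S`, and its free root arcs enter it.
  -- Otherwise `S` is disjoint from the tight packing `X₀`, and feasibility after inserting `S` says
  -- that it spares at least the weights it replaces, which equal `n` on `S`.
  have hge : ∑ v ∈ S, T.n v ≤ T.spare K₀ S := by
    rcases hK₀ with rfl | ⟨X₀, ht₀, hu₀, hn₀⟩
    · have : T.dem Finset.univ S = 0 :=
        Finset.sum_eq_zero fun i _ => if_neg fun h => h.1 (Finset.mem_univ _)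
      unfold spare
      rw [this, sub_zero]
      exact hT.n_le S hSV
    · rcases ht₀.inter hF hT ht hV hu₀ hn₀ (fun h =>
        absurd (Finset.mem_biUnion.mpr ⟨S, hS, huS⟩) h) with h | ⟨S', hS', huS', hd, hle, -⟩
      · rw [Finset.inter_eq_right.mpr hK₁₀.subset] at h
        exact absurd h hnot
      · obtain rfl := ht.1.eq_of_mem hS hS' huS huS'
        have hSX₀ : S ∉ X₀ := fun h => hu₀ (Finset.mem_biUnion.mpr ⟨S, h, huS⟩)
        have hp : IsPacking (insert S X₀) := by
          rw [Finset.insert_eq]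
          exact (IsPacking.singleton ⟨u, huS⟩).union ht₀.1 (by simpa using hd)
        have hu' : (insert S X₀).biUnion id = S ∪ X₀.biUnion id := by simp
        have h1 := hF K₀ (insert S X₀) hp (by
          rw [hu']; exact Finset.union_subset hSV ht₀.2.1)
        have h2 := ht₀.2.2
        unfold val at h1 h2
        rw [Finset.sum_insert hSX₀, hu'] at h1
        have h3 : ∑ v ∈ T.V \ X₀.biUnion id, T.wt K₀ v =
            ∑ v ∈ T.V \ (S ∪ X₀.biUnion id), T.wt K₀ v + ∑ v ∈ S, T.wt K₀ v := by
          rw [← Finset.sum_sdiff (s₁ := S) (s₂ := T.V \ X₀.biUnion id)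
            (fun v hv => Finset.mem_sdiff.mpr ⟨hSV hv, Finset.disjoint_left.mp hd hv⟩),
            sdiff_sdiff_left, Finset.sup_eq_union, Finset.union_comm S]
        have h4 : ∑ v ∈ S, T.wt K₀ v = ∑ v ∈ S, T.n v :=
          Finset.sum_congr rfl fun v hv => min_eq_right (hle v hv)
        linarith
  -- removing `S` from its packing exhausts the arcs to `u`
  refine hnot ⟨X.erase S, ?_⟩
  have hp : IsPacking (X.erase S) := ht.1.mono (Finset.erase_subset _ _)
  have hdS : Disjoint S ((X.erase S).biUnion id) := by
    rw [Finset.disjoint_biUnion_right]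
    exact fun S' hS' => ht.1.2 S hS S' (Finset.mem_of_mem_erase hS')
      (Finset.ne_of_mem_erase hS').symm
  have hXu : X.biUnion id = (X.erase S).biUnion id ∪ S := by
    conv_lhs => rw [← Finset.insert_erase hS]
    rw [Finset.biUnion_insert, id, Finset.union_comm]
  have hpV : (X.erase S).biUnion id ⊆ T.V :=
    (Finset.biUnion_subset_biUnion_of_subset_left _ (Finset.erase_subset _ _)).trans ht.2.1
  have h1 := hF K₁ _ hp hpV
  have h2 : T.val K₁ X = T.val K₁ (X.erase S) + T.spare K₁ S - ∑ v ∈ S, T.wt K₁ v := by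
    unfold val
    rw [← Finset.add_sum_erase X _ hS, hXu, ← Finset.sup_eq_union, ← sdiff_sdiff_left,
      ← Finset.sum_sdiff (s₁ := S) (s₂ := T.V \ (X.erase S).biUnion id)
      (fun v hv => Finset.mem_sdiff.mpr ⟨hSV hv, Finset.disjoint_left.mp hdS hv⟩)]
    ring
  have h3 := ht.2.2
  have h4 : ∑ v ∈ S, T.wt K₁ v ≤ ∑ v ∈ S, T.n v := Finset.sum_le_sum fun v _ => min_le_right _ _
  -- Feasibility without `S` bounds the weights on `S` below by what `S` spares, hence by the sum of
  -- `n`; as each weight is at most `n`, equality holds at every vertex.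
  have h4' : ∑ v ∈ S, T.wt K₁ v = ∑ v ∈ S, T.n v := le_antisymm h4 (by linarith)
  have h5 : ∀ v ∈ S, T.wt K₁ v = T.n v :=
    (Finset.sum_eq_sum_iff_of_le fun v _ => min_le_right _ _).mp h4'
  exact ⟨⟨hp, hpV, by linarith⟩, Finset.disjoint_left.mp hdS huS, min_eq_right_iff.mp (h5 u huS)⟩

end RootData

/-! ### Arborescences as out-trees. -/

namespace MultiDigraph

variable {U A : Type*}

theorem isDiwalk_append (D : MultiDigraph U A) {u v : U} {p q : List A} :
    D.IsDiwalk u (p ++ q) v ↔ ∃ w, D.IsDiwalk u p w ∧ D.IsDiwalk w q v := by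
  induction p generalizing u with
  | nil => simp [IsDiwalk]
  | cons a p ih =>
    simp only [List.cons_append, IsDiwalk, ih]
    constructor
    · rintro ⟨h, w, h1, h2⟩
      exact ⟨w, ⟨h, h1⟩, h2⟩
    · rintro ⟨w, ⟨h, h1⟩, h2⟩
      exact ⟨h, w, h1, h2⟩

theorem isDiwalk_concat (D : MultiDigraph U A) {u v : U} {p : List A} {a : A} :
    D.IsDiwalk u (p ++ [a]) v ↔ D.IsDiwalk u p (D.tail a) ∧ D.head a = v := by
  rw [isDiwalk_append]
  constructor
  · rintro ⟨w, h1, rfl, h2⟩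
    exact ⟨h1, h2⟩
  · rintro ⟨h1, h2⟩
    exact ⟨_, h1, rfl, h2⟩

namespace Subdigraph

variable {D : MultiDigraph U A}

/-- Every vertex of `F` is reached from `r` by arcs of `F`, no two arcs of `F` have the same head,
and no arc of `F` enters `r`. -/
structure IsOutTree (F : D.Subdigraph) (r : U) : Prop where
  root_mem : r ∈ F.verts
  head_inj : ∀ a ∈ F.arcs, ∀ b ∈ F.arcs, D.head a = D.head b → a = b
  head_ne : ∀ a ∈ F.arcs, D.head a ≠ r
  reach : ∀ u ∈ F.verts, ∃ p, D.IsDiwalk r p u ∧ ∀ a ∈ p, a ∈ F.arcs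

theorem IsOutTree.exists_head {F : D.Subdigraph} {r : U} (h : F.IsOutTree r) {u : U}
    (hu : u ∈ F.verts) (hne : u ≠ r) : ∃ a ∈ F.arcs, D.head a = u := by
  obtain ⟨p, hp, hpF⟩ := h.reach u hu
  rcases List.eq_nil_or_concat' p with rfl | ⟨q, a, rfl⟩
  · exact absurd hp.symm hne
  · exact ⟨a, hpF a (by simp), (D.isDiwalk_concat.mp hp).2⟩

/-- The edge of the underlying graph that comes from an arc. -/
def toEdge (F : D.Subdigraph) (a : {a // a ∈ F.arcs}) : F.underlying.edgeSet :=
  ⟨s(⟨D.tail a, F.tail_mem a a.2⟩, ⟨D.head a, F.head_mem a a.2⟩),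
    SimpleGraph.mem_edgeSet _ |>.mpr ⟨a, a.2, Or.inl ⟨rfl, rfl⟩⟩⟩

theorem toEdge_surjective (F : D.Subdigraph) : Function.Surjective F.toEdge := by
  rintro ⟨e, he⟩
  induction e with
  | _ u v =>
    obtain ⟨a, ha, h⟩ := (SimpleGraph.mem_edgeSet _).mp he
    refine ⟨⟨a, ha⟩, Subtype.ext ?_⟩
    rcases h with ⟨h1, h2⟩ | ⟨h1, h2⟩
    · simp [toEdge, h1, h2]
    · simp [toEdge, h1, h2, Sym2.eq_swap]

theorem toEdge_eq_iff (F : D.Subdigraph) (a b : {a // a ∈ F.arcs}) :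
    F.toEdge a = F.toEdge b ↔ s(D.tail a, D.head a) = s(D.tail b, D.head b) := by
  simp [toEdge, Subtype.ext_iff]

/-- A tree has one arc fewer than vertices, and each non-root vertex is the head of the last arc of
its path. So taking heads is a bijection from the arcs to the non-root vertices. -/
theorem IsArborescence.isOutTree {F : D.Subdigraph} {r : U} (h : F.IsArborescence r) :
    F.IsOutTree r := by
  classical
  obtain ⟨hr, ⟨hpar, htree⟩, hpath⟩ := h
  have hcard := (SimpleGraph.isTree_iff_connected_and_card.mp htree).2
  have hinj : Function.Injective F.toEdge := fun a b hab =>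
    Subtype.ext (hpar a a.2 b b.2 ((F.toEdge_eq_iff a b).mp hab))
  have h1 := Nat.card_eq_of_bijective _ ⟨hinj, F.toEdge_surjective⟩
  have h2 : F.arcs.card + 1 = F.verts.card := by
    rw [← h1] at hcard
    simpa using hcard
  have hsub : F.verts.erase r ⊆ F.arcs.image D.head := by
    intro u hu
    obtain ⟨hne, hu⟩ := Finset.mem_erase.mp hu
    obtain ⟨p, ⟨-, hp, hpF, -⟩, -⟩ := hpath u hu
    rcases List.eq_nil_or_concat' p with rfl | ⟨q, a, rfl⟩
    · exact absurd hp.symm hne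
    · exact Finset.mem_image.mpr ⟨a, hpF a (by simp), (D.isDiwalk_concat.mp hp).2⟩
  have h3 := Finset.card_erase_of_mem hr
  have h4 : (F.arcs.image D.head).card ≤ F.arcs.card := Finset.card_image_le
  have h5 := Finset.card_le_card hsub
  have himg : F.verts.erase r = F.arcs.image D.head :=
    Finset.eq_of_subset_of_card_le hsub (by omega)
  have hinj : Set.InjOn D.head F.arcs := Finset.card_image_iff.mp (by omega)
  refine ⟨hr, fun a ha b hb hab => hinj ha hb hab, fun a ha hh => ?_, fun u hu => ?_⟩
  · have : D.head a ∈ F.verts.erase r := himg ▸ Finset.mem_image_of_mem _ ha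
    exact (Finset.mem_erase.mp this).1 hh
  · obtain ⟨p, ⟨-, hp, hpF, -⟩, -⟩ := hpath u hu
    exact ⟨p, hp, hpF⟩

/-- Read backwards: the last arc is determined by its head, and no arc enters the root, so neither
walk can stop early. -/
theorem IsOutTree.walk_unique {F : D.Subdigraph} {r : U} (h : F.IsOutTree r) {p q : List A}
    {u : U} (hp : D.IsDiwalk r p u) (hpF : ∀ a ∈ p, a ∈ F.arcs) (hq : D.IsDiwalk r q u)
    (hqF : ∀ a ∈ q, a ∈ F.arcs) : p = q := by
  induction p using List.reverseRecOn generalizing q u with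
  | nil =>
    rcases List.eq_nil_or_concat' q with rfl | ⟨q, b, rfl⟩
    · rfl
    · have h1 := (D.isDiwalk_concat.mp hq).2
      exact absurd (h1.trans hp.symm) (h.head_ne b (hqF b (by simp)))
  | append_singleton p a ih =>
    obtain ⟨hp1, hp2⟩ := D.isDiwalk_concat.mp hp
    rcases List.eq_nil_or_concat' q with rfl | ⟨q, b, rfl⟩
    · exact absurd (hp2.trans hq.symm) (h.head_ne a (hpF a (by simp)))
    · obtain ⟨hq1, hq2⟩ := D.isDiwalk_concat.mp hq
      obtain rfl := h.head_inj a (hpF a (by simp)) b (hqF b (by simp)) (hp2.trans hq2.symm)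
      rw [ih hp1 (fun c hc => hpF c (by simp [hc])) hq1 (fun c hc => hqF c (by simp [hc]))]

/-- A repeated non-root vertex would be reached both by a walk and by a proper initial segment of
it. -/
theorem IsOutTree.walk_nodup {F : D.Subdigraph} {r : U} (h : F.IsOutTree r) {p : List A}
    {u : U} (hp : D.IsDiwalk r p u) (hpF : ∀ a ∈ p, a ∈ F.arcs) :
    (r :: p.map D.head).Nodup := by
  induction p using List.reverseRecOn generalizing u with
  | nil => simp
  | append_singleton p a ih =>
    obtain ⟨hp1, hp2⟩ := D.isDiwalk_concat.mp hp
    have ih := ih hp1 (fun c hc => hpF c (by simp [hc]))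
    rw [List.map_append, ← List.cons_append, List.nodup_append]
    refine ⟨ih, by simp, ?_⟩
    simp only [List.map_cons, List.map_nil, List.mem_singleton]
    rintro v hv _ rfl rfl
    rcases List.mem_cons.mp hv with hv | hv
    · exact h.head_ne a (hpF a (by simp)) hv
    · obtain ⟨b, hb, hba⟩ := List.mem_map.mp hv
      obtain rfl := h.head_inj b (hpF b (by simp [hb])) a (hpF a (by simp)) hba
      obtain ⟨p₁, p₂, rfl⟩ := List.append_of_mem hb
      have hw : D.IsDiwalk r (p₁ ++ [b]) (D.head b) := by
        rw [isDiwalk_append] at hp1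
        obtain ⟨w, h1, h2⟩ := hp1
        exact D.isDiwalk_concat.mpr ⟨h2.1 ▸ h1, rfl⟩
      have := h.walk_unique hw (fun c hc => hpF c (by simp at hc ⊢; tauto)) (hp2 ▸ hp) hpF
      have := congrArg List.length this
      simp at this

/-- Injectivity of heads allows at most as many arcs as non-root vertices, and connectedness needs
at least as many edges. Equality gives both a tree and the absence of parallel or opposite arcs. -/
theorem IsOutTree.isArborescence {F : D.Subdigraph} {r : U} (h : F.IsOutTree r) :
    F.IsArborescence r := by
  classical
  have hreach : ∀ p u, D.IsDiwalk r p u → (∀ a ∈ p, a ∈ F.arcs) → ∀ hu : u ∈ F.verts,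
      F.underlying.Reachable ⟨r, h.root_mem⟩ ⟨u, hu⟩ := by
    intro p
    induction p using List.reverseRecOn with
    | nil =>
      rintro u rfl - hu
      exact SimpleGraph.Reachable.refl _
    | append_singleton p a ih =>
      intro u hp hpF hu
      obtain ⟨hp1, rfl⟩ := D.isDiwalk_concat.mp hp
      have ha := hpF a (by simp)
      refine (ih _ hp1 (fun c hc => hpF c (by simp [hc])) (F.tail_mem a ha)).trans
        (SimpleGraph.Adj.reachable ?_)
      exact ⟨a, ha, Or.inl ⟨rfl, rfl⟩⟩
  have hconn : F.underlying.Connected := by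
    rw [SimpleGraph.connected_iff_exists_forall_reachable]
    refine ⟨⟨r, h.root_mem⟩, fun ⟨u, hu⟩ => ?_⟩
    obtain ⟨p, hp, hpF⟩ := h.reach u hu
    exact hreach p u hp hpF hu
  have h1 : F.arcs.card ≤ (F.verts.erase r).card :=
    Finset.card_le_card_of_injOn D.head
      (fun a ha => Finset.mem_erase.mpr ⟨h.head_ne a ha, F.head_mem a ha⟩)
      (fun a ha b hb => h.head_inj a ha b hb)
  rw [Finset.card_erase_of_mem h.root_mem] at h1
  have hpos : 0 < F.verts.card := Finset.card_pos.mpr ⟨r, h.root_mem⟩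
  have h2 := hconn.card_vert_le_card_edgeSet_add_one
  have h3 : Nat.card F.underlying.edgeSet ≤ Nat.card {a // a ∈ F.arcs} :=
    Nat.card_le_card_of_surjective _ F.toEdge_surjective
  have h4 : Nat.card {u // u ∈ F.verts} = F.verts.card := by simp
  have h5 : Nat.card {a // a ∈ F.arcs} = F.arcs.card := by simp
  have hbij : Function.Bijective F.toEdge :=
    F.toEdge_surjective.bijective_of_nat_card_le (by omega)
  refine ⟨h.root_mem, ⟨fun a ha b hb hab => ?_,
    SimpleGraph.isTree_iff_connected_and_card.mpr ⟨hconn, by omega⟩⟩, fun u hu => ?_⟩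
  · have := @hbij.1 ⟨a, ha⟩ ⟨b, hb⟩ ((F.toEdge_eq_iff _ _).mpr hab)
    exact congrArg Subtype.val this
  · obtain ⟨p, hp, hpF⟩ := h.reach u hu
    exact ⟨p, ⟨h.root_mem, hp, hpF, h.walk_nodup hp hpF⟩, fun q hq =>
      h.walk_unique hq.2.1 hq.2.2.1 hp hpF⟩

/-- A set of vertices that contains a vertex of the tree but not the root is entered by an arc of
the tree. -/
theorem IsOutTree.exists_entering [DecidableEq U] {F : D.Subdigraph} {r : U}
    (h : F.IsOutTree r) {S : Finset U} {u : U} (hu : u ∈ F.verts) (huS : u ∈ S) (hr : r ∉ S) :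
    ∃ a ∈ F.arcs, D.tail a ∉ S ∧ D.head a ∈ S := by
  obtain ⟨p, hp, hpF⟩ := h.reach u hu
  induction p using List.reverseRecOn generalizing u with
  | nil => exact absurd (hp ▸ huS) hr
  | append_singleton p a ih =>
    obtain ⟨hp1, rfl⟩ := D.isDiwalk_concat.mp hp
    have ha := hpF a (by simp)
    by_cases ht : D.tail a ∈ S
    · exact ih (F.tail_mem a ha) ht hp1 (fun c hc => hpF c (by simp [hc]))
    · exact ⟨a, ha, ht, huS⟩

variable [DecidableEq U] [DecidableEq A]

/-- Add to `F` an arc together with its ends. -/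
def addArc (F : D.Subdigraph) (a : A) (ha : D.tail a ∈ F.verts) : D.Subdigraph where
  verts := insert (D.head a) F.verts
  arcs := insert a F.arcs
  tail_mem b hb := by
    rcases Finset.mem_insert.mp hb with rfl | hb
    exacts [Finset.mem_insert_of_mem ha, Finset.mem_insert_of_mem (F.tail_mem b hb)]
  head_mem b hb := by
    rcases Finset.mem_insert.mp hb with rfl | hb
    exacts [Finset.mem_insert_self _ _, Finset.mem_insert_of_mem (F.head_mem b hb)]

theorem IsOutTree.addArc {F : D.Subdigraph} {r : U} (h : F.IsOutTree r) {a : A}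
    (ha : D.tail a ∈ F.verts) (hh : D.head a ∉ F.verts) : (F.addArc a ha).IsOutTree r where
  root_mem := Finset.mem_insert_of_mem h.root_mem
  head_inj b hb c hc hbc := by
    have key : ∀ b ∈ F.arcs, D.head b ≠ D.head a := fun b hb e => hh (e ▸ F.head_mem b hb)
    rcases Finset.mem_insert.mp hb with rfl | hb' <;> rcases Finset.mem_insert.mp hc with rfl | hc'
    exacts [rfl, absurd hbc.symm (key c hc'), absurd hbc (key b hb'), h.head_inj b hb' c hc' hbc]
  head_ne b hb := by
    rcases Finset.mem_insert.mp hb with rfl | hb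
    exacts [fun e => hh (e ▸ h.root_mem), h.head_ne b hb]
  reach u hu := by
    rcases Finset.mem_insert.mp hu with rfl | hu
    · obtain ⟨p, hp, hpF⟩ := h.reach _ ha
      refine ⟨p ++ [a], D.isDiwalk_concat.mpr ⟨hp, rfl⟩, fun b hb => ?_⟩
      rcases List.mem_append.mp hb with hb | hb
      · exact Finset.mem_insert_of_mem (hpF b hb)
      · rw [List.mem_singleton.mp hb]
        exact Finset.mem_insert_self _ _
    · obtain ⟨p, hp, hpF⟩ := h.reach u hu
      exact ⟨p, hp, fun b hb => Finset.mem_insert_of_mem (hpF b hb)⟩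

theorem isSub_addArc (F : D.Subdigraph) (a : A) (ha : D.tail a ∈ F.verts) :
    F.IsSub (F.addArc a ha) :=
  ⟨Finset.subset_insert _ _, Finset.subset_insert _ _⟩

end Subdigraph

end MultiDigraph

/-! ### Edmonds' theorem on extending out-trees. -/

section MissCount

variable {U ι : Type*} [DecidableEq U] [Fintype ι] [DecidableEq ι]

/-- The number of members of the family `R` that are disjoint from `S`. -/
def missCount (R : ι → Finset U) (S : Finset U) : ℤ :=
  ∑ i, if Disjoint S (R i) then 1 else 0

theorem missCount_add_le (R : ι → Finset U) (S T : Finset U) :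
    missCount R S + missCount R T ≤ missCount R (S ∪ T) + missCount R (S ∩ T) := by
  unfold missCount
  rw [← Finset.sum_add_distrib, ← Finset.sum_add_distrib]
  refine Finset.sum_le_sum fun i _ => ?_
  have e1 : Disjoint S (R i) → Disjoint (S ∩ T) (R i) :=
    fun h => h.mono_left Finset.inter_subset_left
  have e2 : Disjoint T (R i) → Disjoint (S ∩ T) (R i) :=
    fun h => h.mono_left Finset.inter_subset_right
  simp only [Finset.disjoint_union_left]
  by_cases a1 : Disjoint S (R i) <;> by_cases a2 : Disjoint T (R i) <;>
    by_cases a3 : Disjoint (S ∩ T) (R i) <;> simp_all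

/-- Member `i` counts for the intersection alone. The strictness forces the intersection of two
tight sets meeting `R i` to meet it too. -/
theorem missCount_add_lt (R : ι → Finset U) {S T : Finset U} {i : ι}
    (hS : ¬ Disjoint S (R i)) (hT : ¬ Disjoint T (R i)) (h : Disjoint (S ∩ T) (R i)) :
    missCount R S + missCount R T < missCount R (S ∪ T) + missCount R (S ∩ T) := by
  unfold missCount
  rw [← Finset.sum_add_distrib, ← Finset.sum_add_distrib]
  refine Finset.sum_lt_sum (fun j _ => ?_) ⟨i, Finset.mem_univ i, ?_⟩
  · have e1 : Disjoint S (R j) → Disjoint (S ∩ T) (R j) :=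
      fun h => h.mono_left Finset.inter_subset_left
    have e2 : Disjoint T (R j) → Disjoint (S ∩ T) (R j) :=
      fun h => h.mono_left Finset.inter_subset_right
    simp only [Finset.disjoint_union_left]
    clear hS hT h
    by_cases a1 : Disjoint S (R j) <;> by_cases a2 : Disjoint T (R j) <;>
      by_cases a3 : Disjoint (S ∩ T) (R j) <;> simp_all
  · simp [hS, hT, h]

theorem missCount_lt_sdiff (R : ι → Finset U) {S : Finset U} {i : ι}
    (hS : ¬ Disjoint S (R i)) : missCount R S < missCount R (S \ R i) := by
  unfold missCount
  refine Finset.sum_lt_sum (fun j _ => ?_) ⟨i, Finset.mem_univ i, ?_⟩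
  · have : Disjoint S (R j) → Disjoint (S \ R i) (R j) :=
      fun h => h.mono_left Finset.sdiff_subset
    by_cases a1 : Disjoint S (R j) <;> by_cases a2 : Disjoint (S \ R i) (R j) <;> simp_all
  · rw [if_neg hS, if_pos Finset.sdiff_disjoint]
    exact one_pos

theorem missCount_update (R : ι → Finset U) (i : ι) (h : U) (S : Finset U) :
    missCount (Function.update R i (insert h (R i))) S =
      missCount R S - if Disjoint S (R i) ∧ h ∈ S then 1 else 0 := by
  rw [eq_sub_iff_add_eq]
  unfold missCount
  rw [← Finset.add_sum_erase _ _ (Finset.mem_univ i), ← Finset.add_sum_erase _ _ (Finset.mem_univ i)]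
  have hne : ∀ j ∈ Finset.univ.erase i, (if Disjoint S (Function.update R i (insert h (R i)) j)
      then (1 : ℤ) else 0) = if Disjoint S (R j) then 1 else 0 := by
    intro j hj
    rw [Function.update_of_ne (Finset.ne_of_mem_erase hj)]
  rw [Finset.sum_congr rfl hne]
  simp only [Function.update_self, Finset.disjoint_insert_right]
  split_ifs <;> first | tauto | ring

end MissCount

namespace MultiDigraph

variable {U A : Type*} [Fintype U] [DecidableEq U] (D : MultiDigraph U A)

theorem inDeg_eq_sum (B : Finset A) (S : Finset U) :
    (D.inDeg B S : ℤ) = ∑ a ∈ B, if D.tail a ∉ S ∧ D.head a ∈ S then 1 else 0 := by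
  unfold inDeg count
  rw [Finset.card_filter]
  push_cast
  simp only [Finset.mem_compl]

theorem inDeg_submod (B : Finset A) (S T : Finset U) :
    (D.inDeg B (S ∪ T) : ℤ) + D.inDeg B (S ∩ T) ≤ D.inDeg B S + D.inDeg B T := by
  simp only [inDeg_eq_sum, ← Finset.sum_add_distrib, Finset.mem_union, Finset.mem_inter]
  refine Finset.sum_le_sum fun a _ => ?_
  by_cases a1 : D.tail a ∈ S <;> by_cases a2 : D.tail a ∈ T <;> by_cases a3 : D.head a ∈ S <;>
    by_cases a4 : D.head a ∈ T <;> simp [*]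

theorem count_eq_sum (B : Finset A) (x u : U) :
    (D.count B {x} {u} : ℤ) = ∑ a ∈ B, if D.tail a = x ∧ D.head a = u then 1 else 0 := by
  unfold count
  rw [Finset.card_filter]
  push_cast
  simp only [Finset.mem_singleton]

theorem outDeg_eq_sum (B : Finset A) (x : U) :
    (D.outDeg B {x} : ℤ) = ∑ a ∈ B, if D.tail a = x then 1 else 0 := by
  unfold outDeg count
  rw [Finset.card_filter]
  push_cast
  refine Finset.sum_congr rfl fun a _ => ?_
  have := D.loopless a
  by_cases h : D.tail a = x
  · have h' : D.head a ≠ x := fun e => this (h.trans e.symm)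
    simp [h, h']
  · simp [h]

variable [DecidableEq A]

theorem inDeg_erase {B : Finset A} {a : A} (ha : a ∈ B) (S : Finset U) :
    (D.inDeg (B.erase a) S : ℤ) =
      D.inDeg B S - if D.tail a ∉ S ∧ D.head a ∈ S then 1 else 0 := by
  rw [inDeg_eq_sum, inDeg_eq_sum, ← Finset.add_sum_erase B _ ha]
  ring

/-- If the cut condition holds, some free arc can be added to the `i`-th tree without violating
it. -/
theorem exists_arc_of_cut_condition {ι : Type*} [Fintype ι] [DecidableEq ι] (B : Finset A)
    (R : ι → Finset U) {r u : U} {i : ι} (hr : r ∈ R i) (hu : u ∉ R i)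
    (hcut : ∀ S : Finset U, S.Nonempty → r ∉ S → missCount R S ≤ D.inDeg B S) :
    ∃ a ∈ B, D.tail a ∈ R i ∧ D.head a ∉ R i ∧ ∀ S : Finset U, S.Nonempty → r ∉ S →
      missCount (Function.update R i (insert (D.head a) (R i))) S ≤ D.inDeg (B.erase a) S := by
  classical
  have bad : ∀ a ∈ B, D.tail a ∈ R i → (¬ ∀ S : Finset U, S.Nonempty → r ∉ S →
      missCount (Function.update R i (insert (D.head a) (R i))) S ≤ D.inDeg (B.erase a) S) →
      ∃ S : Finset U, r ∉ S ∧ (D.inDeg B S : ℤ) ≤ missCount R S ∧ D.tail a ∉ S ∧ D.head a ∈ S ∧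
        ¬ Disjoint S (R i) := by
    intro a ha hat h
    push Not at h
    obtain ⟨S, hS, hrS, hlt⟩ := h
    have h1 := hcut S hS hrS
    rw [missCount_update, D.inDeg_erase ha] at hlt
    by_cases c1 : D.tail a ∈ S
    · have c2 : ¬ Disjoint S (R i) := Finset.not_disjoint_iff.mpr ⟨_, c1, hat⟩
      simp only [c1, c2, not_true_eq_false, false_and, if_false] at hlt
      omega
    · by_cases c2 : D.head a ∈ S
      · by_cases c3 : Disjoint S (R i)
        · simp only [c1, c2, c3, not_false_eq_true, and_self, if_true] at hlt
          omega
        · simp only [c1, c2, c3, not_false_eq_true, and_self, false_and, if_true, if_false] at hlt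
          exact ⟨S, hrS, by omega, c1, c2, c3⟩
      · simp only [c2, and_false, if_false] at hlt
        omega
  -- A set blocking an arc that leaves `R i` contains the head of that arc, so it is not inside `R
  -- i` and belongs to `C`. If `C` is empty, any free arc leaving `R i` will do.
  let C : Finset (Finset U) := Finset.univ.filter fun S =>
    r ∉ S ∧ (D.inDeg B S : ℤ) ≤ missCount R S ∧ ¬ Disjoint S (R i) ∧ ¬ S ⊆ R i
  rcases C.eq_empty_or_nonempty with hC | hC
  · have h1 := hcut (R i)ᶜ ⟨u, by simpa using hu⟩ (by simpa using hr)
    have h2 : 0 < missCount R (R i)ᶜ := by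
      unfold missCount
      refine Finset.sum_pos' (fun j _ => by split_ifs <;> simp) ⟨i, Finset.mem_univ i, ?_⟩
      rw [if_pos disjoint_compl_left]
      exact one_pos
    have h3 : 0 < D.inDeg B (R i)ᶜ := by exact_mod_cast h2.trans_le h1
    obtain ⟨a, ha⟩ := Finset.card_pos.mp h3
    obtain ⟨haB, hat, hah⟩ := Finset.mem_filter.mp ha
    rw [compl_compl] at hat
    refine ⟨a, haB, hat, by simpa using hah, ?_⟩
    by_contra h
    obtain ⟨S, hrS, hle, -, hhS, hd⟩ := bad a haB hat h
    have : S ∈ C := Finset.mem_filter.mpr ⟨Finset.mem_univ _, hrS, hle, hd, fun hsub =>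
      (Finset.mem_compl.mp hah) (hsub hhS)⟩
    rw [hC] at this
    exact absurd this (Finset.notMem_empty _)
  · obtain ⟨S, hSC, hmin⟩ := C.exists_minimal hC
    obtain ⟨-, hrS, hle, hd, hsub⟩ := Finset.mem_filter.mp hSC
    have hne : (S \ R i).Nonempty := Finset.sdiff_nonempty.mpr hsub
    have h1 := hcut (S \ R i) hne (fun h => hrS (Finset.mem_sdiff.mp h).1)
    have h2 := missCount_lt_sdiff R hd
    -- Removing `R i` from the tight set `S` raises the demand, so more arcs enter `S \ R i` than
    -- `S`; one of them must start in `S ∩ R i`.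
    have h3 : (D.inDeg B S : ℤ) < D.inDeg B (S \ R i) := by linarith
    rw [inDeg_eq_sum, inDeg_eq_sum] at h3
    obtain ⟨a, ha, hlt⟩ := Finset.exists_lt_of_sum_lt h3
    have hin : D.tail a ∉ S \ R i ∧ D.head a ∈ S \ R i := by
      by_contra h
      rw [if_neg h] at hlt
      split_ifs at hlt <;> omega
    have hout : ¬ (D.tail a ∉ S ∧ D.head a ∈ S) := by
      intro h
      rw [if_pos h, if_pos hin] at hlt
      omega
    obtain ⟨hhS, hhR⟩ := Finset.mem_sdiff.mp hin.2
    have htS : D.tail a ∈ S := by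
      by_contra h
      exact hout ⟨h, hhS⟩
    have htR : D.tail a ∈ R i := by
      by_contra h
      exact hin.1 (Finset.mem_sdiff.mpr ⟨htS, h⟩)
    refine ⟨a, ha, htR, hhR, ?_⟩
    by_contra h
    obtain ⟨S', hrS', hle', htS', hhS', hd'⟩ := bad a ha htR h
    have hmem : D.head a ∈ S ∩ S' := Finset.mem_inter.mpr ⟨hhS, hhS'⟩
    have c1 := hcut (S ∪ S') ⟨_, Finset.mem_union_left _ hhS⟩ (by simp [hrS, hrS'])
    have c2 := hcut (S ∩ S') ⟨_, hmem⟩ (by simp [hrS])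
    have c3 := D.inDeg_submod B S S'
    have c4 := missCount_add_le R S S'
    have c5 : ¬ Disjoint (S ∩ S') (R i) := by
      intro hdis
      have := missCount_add_lt R hd hd' hdis
      linarith
    -- Uncrossing makes `S ∩ S'` tight; it lacks the tail of the arc, so it is a smaller member of
    -- `C`.
    have : S ∩ S' ∈ C := Finset.mem_filter.mpr ⟨Finset.mem_univ _, by simp [hrS], by linarith, c5,
      fun hs => hhR (hs hmem)⟩
    exact htS' (Finset.mem_inter.mp (hmin this Finset.inter_subset_left htS)).2

variable {D} [Fintype A] {k : ℕ}

theorem mem_freeArcs {F : Fin k → D.Subdigraph} {a : A} :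
    a ∈ freeArcs F ↔ ∀ i, a ∉ (F i).arcs := by
  simp [freeArcs]

theorem freeArcs_update {F : Fin k → D.Subdigraph} {a : A} (i : Fin k)
    (ht : D.tail a ∈ (F i).verts) :
    freeArcs (Function.update F i ((F i).addArc a ht)) = (freeArcs F).erase a := by
  ext b
  simp only [mem_freeArcs, Finset.mem_erase]
  constructor
  · intro h
    have hi := h i
    rw [Function.update_self] at hi
    have hi : b ∉ insert a (F i).arcs := hi
    rw [Finset.mem_insert, not_or] at hi
    refine ⟨hi.1, fun j => ?_⟩
    by_cases hj : j = i
    · exact hj ▸ hi.2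
    · have := h j
      rwa [Function.update_of_ne hj] at this
  · rintro ⟨hne, h⟩ j
    by_cases hj : j = i
    · subst hj
      rw [Function.update_self]
      exact fun hb => (Finset.mem_insert.mp hb).elim hne (h j)
    · rw [Function.update_of_ne hj]
      exact h j

theorem ArcDisjoint.update {F : Fin k → D.Subdigraph} (hF : ArcDisjoint F) {a : A}
    (ha : a ∈ freeArcs F) (i : Fin k) (ht : D.tail a ∈ (F i).verts) :
    ArcDisjoint (Function.update F i ((F i).addArc a ht)) := by
  rw [mem_freeArcs] at ha
  have key : ∀ j, j ≠ i → Disjoint ((F i).addArc a ht).arcs (F j).arcs := by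
    intro j hj
    exact Finset.disjoint_insert_left.mpr ⟨ha j, hF i j (Ne.symm hj)⟩
  intro j l hjl
  by_cases hj : j = i
  · subst hj
    rw [Function.update_self, Function.update_of_ne (Ne.symm hjl)]
    exact key l (Ne.symm hjl)
  · by_cases hl : l = i
    · subst hl
      rw [Function.update_self, Function.update_of_ne hj]
      exact (key j hj).symm
    · rw [Function.update_of_ne hj, Function.update_of_ne hl]
      exact hF j l hjl

theorem isOutTree_update {F : Fin k → D.Subdigraph} {r : U} (hF : ∀ i, (F i).IsOutTree r) {a : A}
    (i : Fin k) (ht : D.tail a ∈ (F i).verts) (hh : D.head a ∉ (F i).verts) (j : Fin k) :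
    (Function.update F i ((F i).addArc a ht) j).IsOutTree r := by
  by_cases hj : j = i
  · subst hj
    rw [Function.update_self]
    exact (hF j).addArc ht hh
  · rw [Function.update_of_ne hj]
    exact hF j

theorem isSub_update (F : Fin k → D.Subdigraph) {a : A} (i : Fin k)
    (ht : D.tail a ∈ (F i).verts) (j : Fin k) :
    (F j).IsSub (Function.update F i ((F i).addArc a ht) j) := by
  by_cases hj : j = i
  · subst hj
    rw [Function.update_self]
    exact (F j).isSub_addArc a ht
  · rw [Function.update_of_ne hj]
    exact ⟨le_rfl, le_rfl⟩

theorem verts_update (F : Fin k → D.Subdigraph) {a : A} (i : Fin k)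
    (ht : D.tail a ∈ (F i).verts) :
    (fun j => (Function.update F i ((F i).addArc a ht) j).verts) =
      Function.update (fun j => (F j).verts) i (insert (D.head a) (F i).verts) := by
  funext j
  by_cases hj : j = i
  · subst hj
    rw [Function.update_self, Function.update_self]
    rfl
  · rw [Function.update_of_ne hj, Function.update_of_ne hj]

theorem Subdigraph.IsSub.trans {F G H : D.Subdigraph} (h : F.IsSub G) (h' : G.IsSub H) :
    F.IsSub H :=
  ⟨h.1.trans h'.1, h.2.trans h'.2⟩

/-- **Edmonds' theorem**: arc-disjoint out-trees with a common root can be extended to arc-disjoint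
spanning out-trees if every set of non-root vertices is entered by as many free arcs as there are
trees that miss it. -/
theorem exists_spanning_of_cut_condition {r : U} (F : Fin k → D.Subdigraph)
    (hF : ∀ i, (F i).IsOutTree r) (hdis : ArcDisjoint F)
    (hcut : ∀ S : Finset U, S.Nonempty → r ∉ S →
      missCount (fun i => (F i).verts) S ≤ D.inDeg (freeArcs F) S) :
    ∃ F' : Fin k → D.Subdigraph, (∀ i, (F i).IsSub (F' i)) ∧ (∀ i, (F' i).IsOutTree r) ∧
      (∀ i, (F' i).IsSpanning) ∧ ArcDisjoint F' := by
  induction hn : (freeArcs F).card using Nat.strong_induction_on generalizing F with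
  | _ n ih =>
    by_cases hsp : ∀ i, (F i).IsSpanning
    · exact ⟨F, fun i => ⟨le_rfl, le_rfl⟩, hF, hsp, hdis⟩
    · unfold Subdigraph.IsSpanning at hsp
      push Not at hsp
      obtain ⟨i, u, hu⟩ := hsp
      obtain ⟨a, ha, ht, hh, hcut'⟩ := D.exists_arc_of_cut_condition (freeArcs F)
        (fun i => (F i).verts) (hF i).root_mem hu hcut
      obtain ⟨F', h1, h2, h3, h4⟩ := ih _ (by
          rw [← hn, freeArcs_update i ht]
          exact Finset.card_erase_lt_of_mem ha)
        (Function.update F i ((F i).addArc a ht)) (isOutTree_update hF i ht hh)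
        (hdis.update ha i ht) (by rwa [freeArcs_update i ht, verts_update F i ht]) rfl
      exact ⟨F', fun j => (isSub_update F i ht j).trans (h1 j), h2, h3, h4⟩

end MultiDigraph

/-- Only the values of `d` inside `V` matter. This is needed because `addRoot` lowers `d` on every
set containing the head, whereas an arc from the root does not enter a set containing the root. -/
theorem RootData.Feasible.congr {U ι β : Type*} [DecidableEq U] [DecidableEq β] [Fintype ι]
    [DecidableEq ι] {T T' : RootData U ι β} (h : T.Feasible) (hV : T'.V = T.V)
    (hb : T'.block = T.block) (hR : T'.R = T.R) (hn : T'.n = T.n) (hc : T'.c = T.c)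
    (hd : ∀ S ⊆ T.V, T'.d S = T.d S) : T'.Feasible := by
  obtain ⟨V, b, R, d, n, c⟩ := T
  obtain ⟨V', b', R', d', n', c'⟩ := T'
  dsimp only at hV hb hR hn hc hd
  subst hV hb hR hn hc
  intro K X hX hXV
  refine (h K X hX hXV).trans (le_of_eq ?_)
  unfold RootData.val
  congr 1
  refine Finset.sum_congr rfl fun S hS => ?_
  have := hd S ((Finset.subset_biUnion_of_mem id hS).trans hXV)
  unfold RootData.spare
  rw [show RootData.d _ S = d S from rfl, ← this]
  rfl

/-! ### Feasibility and the existence of spanning out-trees. -/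

namespace MultiDigraph

variable {U A : Type*} [Fintype U] [DecidableEq U] [Fintype A] [DecidableEq A]
  {D : MultiDigraph U A} {k : ℕ} {β : Type*} [DecidableEq β]

/-- The numerical data of a family of out-trees with root `x`. -/
def rootData (F : Fin k → D.Subdigraph) (x : U) (b : Fin k → β) (c : β → ℤ) :
    RootData U (Fin k) β where
  V := Finset.univ.erase x
  block := b
  R i := (F i).verts
  d S := D.inDeg (freeArcs F) S
  n v := D.count (freeArcs F) {x} {v}
  c α := c α - ∑ i with b i = α, (D.outDeg (F i).arcs {x} : ℤ)

theorem rootData_valid (F : Fin k → D.Subdigraph) (x : U) (b : Fin k → β) (c : β → ℤ) :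
    (rootData F x b c).Valid where
  n_nonneg v := Int.natCast_nonneg _
  submod := D.inDeg_submod _
  n_le S hS := by
    have hx : x ∉ S := fun h => (Finset.mem_erase.mp (hS h)).1 rfl
    simp only [rootData, count_eq_sum, inDeg_eq_sum]
    rw [Finset.sum_comm]
    refine Finset.sum_le_sum fun a _ => ?_
    by_cases ht : D.tail a = x
    · simp [ht, hx]
    · simp only [ht, false_and, if_false, Finset.sum_const_zero]
      split_ifs <;> simp

theorem rootData_update_feasible {F : Fin k → D.Subdigraph} {x : U} {b : Fin k → β} {c : β → ℤ}
    (i : Fin k) {a : A} (ha : a ∈ freeArcs F) (hax : D.tail a = x)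
    (ht : D.tail a ∈ (F i).verts)
    (h : ((rootData F x b c).addRoot (D.head a) i).Feasible) :
    (rootData (Function.update F i ((F i).addArc a ht)) x b c).Feasible := by
  refine h.congr rfl rfl (verts_update F i ht) ?_ ?_ ?_
  · funext v
    simp only [rootData, RootData.addRoot, freeArcs_update, count_eq_sum]
    rw [← Finset.add_sum_erase (freeArcs F) _ ha]
    by_cases hv : D.head a = v
    · simp [hax, hv]
    · simp [hv, Ne.symm hv]
  · funext α
    simp only [rootData, RootData.addRoot]
    have hsum : ∑ j with b j = α, (D.outDeg (Function.update F i ((F i).addArc a ht) j).arcs {x} : ℤ)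
        = ∑ j with b j = α, ((D.outDeg (F j).arcs {x} : ℤ) + if j = i then 1 else 0) := by
      refine Finset.sum_congr rfl fun j _ => ?_
      by_cases hj : j = i
      · subst hj
        rw [Function.update_self, if_pos rfl, outDeg_eq_sum, outDeg_eq_sum]
        have : a ∉ (F j).arcs := mem_freeArcs.mp ha j
        rw [show ((F j).addArc a ht).arcs = insert a (F j).arcs from rfl,
          Finset.sum_insert this, if_pos hax, add_comm]
      · rw [Function.update_of_ne hj, if_neg hj, add_zero]
    rw [hsum, Finset.sum_add_distrib, Finset.sum_ite_eq']
    simp only [Finset.mem_filter, Finset.mem_univ, true_and, eq_comm (a := α)]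
    ring
  · intro S hS
    have hx : x ∉ S := fun h => (Finset.mem_erase.mp (hS h)).1 rfl
    simp only [rootData, RootData.addRoot, freeArcs_update, D.inDeg_erase ha, hax, hx,
      not_false_eq_true, true_and]

theorem outDeg_mono {B C : Finset A} (h : B ⊆ C) (S : Finset U) : D.outDeg B S ≤ D.outDeg C S :=
  Finset.card_le_card (Finset.filter_subset_filter _ h)

/-- Feasibility of the numerical data suffices for the extension to spanning out-trees with
prescribed numbers of root arcs. -/
theorem exists_spanning_of_feasible [Fintype β] {x : U} {b : Fin k → β} {c : β → ℤ}
    (F : Fin k → D.Subdigraph) (hF : ∀ i, (F i).IsOutTree x) (hdis : ArcDisjoint F)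
    (hfeas : (rootData F x b c).Feasible) :
    ∃ F' : Fin k → D.Subdigraph, (∀ i, (F i).IsSub (F' i)) ∧ (∀ i, (F' i).IsOutTree x) ∧
      (∀ i, (F' i).IsSpanning) ∧ ArcDisjoint F' ∧
      ∀ α, c α ≤ ∑ i with b i = α, (D.outDeg (F' i).arcs {x} : ℤ) := by
  induction hn : (freeArcs F).card using Nat.strong_induction_on generalizing F with
  | _ n ih =>
    by_cases hex : ∃ u ∈ Finset.univ.erase x, 0 < (rootData F x b c).n u ∧
        ∃ i, u ∉ (rootData F x b c).R i
    · obtain ⟨u, hu, hpos, hi⟩ := hex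
      obtain ⟨i, hi, hfeas'⟩ := hfeas.exists_addRoot (rootData_valid F x b c) hu hpos hi
      have hpos' : 0 < D.count (freeArcs F) {x} {u} := Int.natCast_pos.mp hpos
      obtain ⟨a, ha⟩ := Finset.card_pos.mp hpos'
      obtain ⟨haf, hax, hau⟩ := Finset.mem_filter.mp ha
      rw [Finset.mem_singleton] at hax hau
      subst hau
      have ht : D.tail a ∈ (F i).verts := hax ▸ (hF i).root_mem
      obtain ⟨F', h1, h2⟩ := ih _ (by
          rw [← hn, freeArcs_update i ht]
          exact Finset.card_erase_lt_of_mem haf)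
        (Function.update F i ((F i).addArc a ht)) (isOutTree_update hF i ht hi)
        (hdis.update haf i ht) (rootData_update_feasible i haf hax ht hfeas') rfl
      exact ⟨F', fun j => (isSub_update F i ht j).trans (h1 j), h2⟩
    · push Not at hex
      obtain ⟨F', h1, h2, h3, h4⟩ := exists_spanning_of_cut_condition F hF hdis (by
        intro S hS hx
        -- At the empty level there is no demand and no weight, so a single set yields exactly the
        -- cut condition.
        have h := hfeas ∅ {S} (IsPacking.singleton hS) (by
          intro v hv
          rw [Finset.singleton_biUnion] at hv
          exact Finset.mem_erase.mpr ⟨fun e => hx (e ▸ hv), Finset.mem_univ _⟩)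
        have hw : ∀ v, (rootData F x b c).wt ∅ v ≤ 0 := fun v =>
          (min_le_left _ _).trans (le_of_eq (by simp [RootData.cap]))
        have hd : (rootData F x b c).dem ∅ S = missCount (fun i => (F i).verts) S := by
          simp [RootData.dem, missCount, rootData]
        unfold RootData.val RootData.spare at h
        rw [Finset.sum_empty, Finset.sum_singleton, hd] at h
        have := Finset.sum_nonpos fun v (_ : v ∈ (rootData F x b c).V \
          ({S} : Finset (Finset U)).biUnion id) => hw v
        have e : (rootData F x b c).d S = D.inDeg (freeArcs F) S := rfl
        linarith)
      refine ⟨F', h1, h2, h3, h4, fun α => ?_⟩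
      -- No free root arc is usable any more, so every weight is nonpositive and the outstanding
      -- demand of block `α` is too. Extending the trees cannot reduce their root degrees.
      have h := hfeas {α} ∅ (by simp [IsPacking]) (by simp)
      have hw : ∀ v ∈ (rootData F x b c).V \ (∅ : Finset (Finset U)).biUnion id,
          (rootData F x b c).wt {α} v ≤ 0 := by
        intro v hv
        by_cases hpos : 0 < (rootData F x b c).n v
        · have hall := hex v (Finset.mem_sdiff.mp hv).1 hpos
          refine (min_le_left _ _).trans (le_of_eq (Finset.sum_eq_zero fun i _ => ?_))
          exact if_neg fun hh => hh.2 (hall i)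
        · exact (min_le_right _ _).trans (not_lt.mp hpos)
      have h5 := Finset.sum_nonpos hw
      unfold RootData.val at h
      rw [Finset.sum_singleton, Finset.sum_empty] at h
      have h6 : (rootData F x b c).c α = c α - ∑ i with b i = α, (D.outDeg (F i).arcs {x} : ℤ) :=
        rfl
      have h7 : ∑ i with b i = α, (D.outDeg (F i).arcs {x} : ℤ) ≤
          ∑ i with b i = α, (D.outDeg (F' i).arcs {x} : ℤ) :=
        Finset.sum_le_sum fun i _ => Int.ofNat_le.mpr (outDeg_mono (h1 i).2 _)
      linarith

/-- The numbers of arcs that the members of `F'` have outside `F` add up to at most the number of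
free arcs. -/
theorem sum_card_filter_sdiff_le {F F' : Fin k → D.Subdigraph} (hsub : ∀ i, (F i).IsSub (F' i))
    (hdis : ArcDisjoint F') (P : A → Prop) [DecidablePred P] :
    ∑ i, (∑ a ∈ (F' i).arcs \ (F i).arcs, if P a then (1 : ℤ) else 0) ≤
      ∑ a ∈ freeArcs F, if P a then 1 else 0 := by
  rw [← Finset.sum_biUnion]
  · refine Finset.sum_le_sum_of_subset_of_nonneg ?_ fun a _ _ => by split_ifs <;> simp
    intro a ha
    obtain ⟨i, -, hi⟩ := Finset.mem_biUnion.mp ha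
    obtain ⟨h1, h2⟩ := Finset.mem_sdiff.mp hi
    rw [mem_freeArcs]
    intro j hj
    by_cases hij : i = j
    · exact h2 (hij ▸ hj)
    · exact Finset.disjoint_left.mp (hdis i j hij) h1 ((hsub j).2 hj)
  · intro i _ j _ hij
    exact (hdis i j hij).mono Finset.sdiff_subset Finset.sdiff_subset

/-- New root arcs of blocks in `K` meet the demand. Those into an uncovered vertex number at most
its weight; those into `S`, and one new arc entering `S` for each member outside `K` that misses
`S`, are distinct free arcs entering `S`. -/
theorem feasible_of_exists_spanning {x : U} {b : Fin k → β} {c : β → ℤ}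
    {F F' : Fin k → D.Subdigraph} (hF : ∀ i, (F i).IsOutTree x) (hsub : ∀ i, (F i).IsSub (F' i))
    (hF' : ∀ i, (F' i).IsOutTree x) (hsp : ∀ i, (F' i).IsSpanning) (hdis : ArcDisjoint F')
    (hc : ∀ α, c α ≤ ∑ i with b i = α, (D.outDeg (F' i).arcs {x} : ℤ)) :
    (rootData F x b c).Feasible := by
  intro K X hX hXV
  -- Otherwise the new arc would share its head with an arc of `F i`, as its head is not the root.
  have hnew : ∀ i, ∀ a ∈ (F' i).arcs \ (F i).arcs, D.head a ∉ (F i).verts := by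
    intro i a ha hh
    obtain ⟨h1, h2⟩ := Finset.mem_sdiff.mp ha
    obtain ⟨a', ha', he⟩ := (hF i).exists_head hh ((hF' i).head_ne a h1)
    exact h2 ((hF' i).head_inj a' ((hsub i).2 ha') a h1 he ▸ ha')
  let N : U → ℤ := fun v => ∑ i, if b i ∈ K then
    ∑ a ∈ (F' i).arcs \ (F i).arcs, (if D.tail a = x ∧ D.head a = v then (1 : ℤ) else 0) else 0
  have hNwt : ∀ v, N v ≤ (rootData F x b c).wt K v := by
    intro v
    refine le_min (Finset.sum_le_sum fun i _ => ?_) ?_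
    · change _ ≤ if b i ∈ K ∧ v ∉ (F i).verts then (1 : ℤ) else 0
      by_cases hi : b i ∈ K
      · by_cases hv : v ∈ (F i).verts
        · simp only [hi, hv, not_true_eq_false, and_false, if_true, if_false]
          refine le_of_eq (Finset.sum_eq_zero fun a ha => if_neg fun h => hnew i a ha ?_)
          exact h.2 ▸ hv
        · simp only [hi, hv, not_false_eq_true, and_true, if_true]
          rw [← Finset.sum_filter, Finset.sum_const, nsmul_one]
          have : (((F' i).arcs \ (F i).arcs).filter
              fun a => D.tail a = x ∧ D.head a = v).card ≤ 1 := by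
            rw [Finset.card_le_one]
            intro a ha a' ha'
            obtain ⟨h1, -, h2⟩ := Finset.mem_filter.mp ha
            obtain ⟨h1', -, h2'⟩ := Finset.mem_filter.mp ha'
            exact (hF' i).head_inj a (Finset.mem_sdiff.mp h1).1 a' (Finset.mem_sdiff.mp h1').1
              (h2.trans h2'.symm)
          exact_mod_cast this
      · simp [hi]
    · change _ ≤ (D.count (freeArcs F) {x} {v} : ℤ)
      rw [count_eq_sum]
      refine le_trans (Finset.sum_le_sum fun i _ => ?_)
        (sum_card_filter_sdiff_le hsub hdis fun a => D.tail a = x ∧ D.head a = v)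
      split_ifs
      · exact le_rfl
      · exact Finset.sum_nonneg fun a _ => by split_ifs <;> simp
  have hNspare : ∀ S ∈ X, ∑ v ∈ S, N v ≤ (rootData F x b c).spare K S := by
    intro S hS
    have hx : x ∉ S := fun h => (Finset.mem_erase.mp
      (hXV (Finset.mem_biUnion.mpr ⟨S, hS, h⟩))).1 rfl
    unfold RootData.spare
    rw [le_sub_iff_add_le]
    change _ ≤ (D.inDeg (freeArcs F) S : ℤ)
    rw [inDeg_eq_sum]
    refine le_trans ?_ (sum_card_filter_sdiff_le hsub hdis fun a => D.tail a ∉ S ∧ D.head a ∈ S)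
    unfold RootData.dem
    rw [Finset.sum_comm, ← Finset.sum_add_distrib]
    refine Finset.sum_le_sum fun i _ => ?_
    change _ + (if b i ∉ K ∧ Disjoint S (F i).verts then (1 : ℤ) else 0) ≤ _
    by_cases hi : b i ∈ K
    · simp only [hi, if_true, not_true_eq_false, false_and, if_false, add_zero]
      rw [Finset.sum_comm]
      refine Finset.sum_le_sum fun a _ => ?_
      by_cases ht : D.tail a = x
      · simp [ht, hx]
      · simp only [ht, false_and, if_false, Finset.sum_const_zero]
        split_ifs <;> simp
    · simp only [hi, if_false, Finset.sum_const_zero, zero_add, not_false_eq_true, true_and]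
      have hnn : ∀ a ∈ (F' i).arcs \ (F i).arcs,
          (0 : ℤ) ≤ if D.tail a ∉ S ∧ D.head a ∈ S then 1 else 0 :=
        fun a _ => by split_ifs <;> simp
      split_ifs with hd
      · obtain ⟨u, hu⟩ := hX.1 S hS
        obtain ⟨a, ha, h1, h2⟩ := (hF' i).exists_entering (hsp i u) hu hx
        have ha' : a ∈ (F' i).arcs \ (F i).arcs := Finset.mem_sdiff.mpr ⟨ha, fun h =>
          Finset.disjoint_left.mp hd h2 ((F i).head_mem a h)⟩
        refine le_trans ?_ (Finset.single_le_sum hnn ha')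
        rw [if_pos ⟨h1, h2⟩]
      · exact Finset.sum_nonneg hnn
  have hdem : ∑ α ∈ K, (rootData F x b c).c α ≤ ∑ v ∈ Finset.univ.erase x, N v := by
    have h1 : ∀ α ∈ K, (rootData F x b c).c α ≤ ∑ i with b i = α,
        ∑ a ∈ (F' i).arcs \ (F i).arcs, if D.tail a = x then (1 : ℤ) else 0 := by
      intro α _
      change c α - ∑ i with b i = α, (D.outDeg (F i).arcs {x} : ℤ) ≤ _
      rw [sub_le_iff_le_add, ← Finset.sum_add_distrib]
      refine (hc α).trans (le_of_eq (Finset.sum_congr rfl fun i _ => ?_))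
      rw [outDeg_eq_sum, outDeg_eq_sum, Finset.sum_sdiff (hsub i).2]
    refine (Finset.sum_le_sum h1).trans (le_of_eq ?_)
    rw [Finset.sum_comm]
    have h2 : ∀ i, (if b i ∈ K then ∑ a ∈ (F' i).arcs \ (F i).arcs,
        (if D.tail a = x then (1 : ℤ) else 0) else 0) = ∑ v ∈ Finset.univ.erase x,
        if b i ∈ K then ∑ a ∈ (F' i).arcs \ (F i).arcs,
          (if D.tail a = x ∧ D.head a = v then (1 : ℤ) else 0) else 0 := by
      intro i
      split_ifs
      · rw [Finset.sum_comm]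
        refine Finset.sum_congr rfl fun a ha => ?_
        have hne := (hF' i).head_ne a (Finset.mem_sdiff.mp ha).1
        by_cases ht : D.tail a = x
        · simp [ht, hne]
        · simp [ht]
      · simp
    rw [← Finset.sum_congr rfl fun i _ => h2 i]
    simp only [Finset.sum_filter]
    rw [Finset.sum_comm]
    refine Finset.sum_congr rfl fun i _ => ?_
    rw [Finset.sum_ite_eq]
  refine hdem.trans ?_
  have hV : (rootData F x b c).V = Finset.univ.erase x := rfl
  unfold RootData.val
  rw [hV] at hXV ⊢
  rw [← Finset.sum_sdiff hXV, hX.sum_biUnion, add_comm]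
  exact add_le_add (Finset.sum_le_sum hNspare) (Finset.sum_le_sum fun v _ => hNwt v)

end MultiDigraph

/-! ### Translation into the stated inequality. -/

namespace MultiDigraph

variable {U A : Type*} [Fintype U] [DecidableEq U] [Fintype A] [DecidableEq A]
  {D : MultiDigraph U A} {k l : ℕ}

theorem card_missing (F : Fin k → D.Subdigraph) (x : U) {block : Fin l → Finset (Fin k)}
    {b : Fin k → Fin l} (hb : ∀ i α, i ∈ block α ↔ b i = α) (c : Fin l → ℤ) (J : Finset (Fin l))
    (S : Finset U) :
    ((missing F (J.biUnion block) S).card : ℤ) = (rootData F x b c).dem Jᶜ S := by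
  unfold missing RootData.dem
  rw [Finset.card_filter, Nat.cast_sum]
  have : J.biUnion block = Finset.univ.filter fun i => b i ∈ J := by
    ext i
    simp [hb]
  rw [this, Finset.sum_filter]
  refine Finset.sum_congr rfl fun i _ => ?_
  simp only [rootData, Finset.mem_compl, not_not, Finset.disjoint_iff_inter_eq_empty]
  by_cases h1 : b i ∈ J <;> by_cases h2 : S ∩ (F i).verts = ∅ <;> simp [h1, h2]

theorem weight_eq_wt (F : Fin k → D.Subdigraph) (x : U) {block : Fin l → Finset (Fin k)}
    {b : Fin k → Fin l} (hb : ∀ i α, i ∈ block α ↔ b i = α) (c : Fin l → ℤ) (J : Finset (Fin l))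
    (u : U) :
    (weight F x (J.biUnion block)ᶜ u : ℤ) = (rootData F x b c).wt Jᶜ u := by
  have hcap : (((J.biUnion block)ᶜ.filter fun i => u ∉ (F i).verts).card : ℤ) =
      (rootData F x b c).cap Jᶜ u := by
    have : (J.biUnion block)ᶜ = Finset.univ.filter fun i => b i ∉ J := by
      ext i
      simp [hb]
    rw [this, Finset.filter_filter, Finset.card_filter, Nat.cast_sum]
    refine Finset.sum_congr rfl fun i _ => ?_
    simp only [rootData, Finset.mem_compl]
    push_cast
    rfl
  unfold weight RootData.wt
  rw [← hcap]
  split_ifs with h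
  · rw [Nat.cast_min]
    rfl
  · have h0 : D.count (freeArcs F) {x} {u} = 0 := by
      unfold count
      rw [Finset.card_eq_zero, Finset.filter_eq_empty_iff]
      rintro a - ⟨h1, h2⟩
      rw [Finset.mem_singleton] at h1 h2
      exact h (Finset.mem_image.mpr ⟨a, Finset.mem_filter.mpr ⟨Finset.mem_univ _, h1⟩, h2⟩)
    have hn : (rootData F x b c).n u = 0 := by
      change (D.count (freeArcs F) {x} {u} : ℤ) = 0
      rw [h0, Nat.cast_zero]
    rw [hn, Nat.cast_zero, min_eq_right (Int.natCast_nonneg _)]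

theorem val_image (F : Fin k → D.Subdigraph) (x : U) {block : Fin l → Finset (Fin k)}
    {b : Fin k → Fin l} (hb : ∀ i α, i ∈ block α ↔ b i = α) (c : Fin l → ℤ) (J : Finset (Fin l))
    {t : ℕ} {X : Fin t → Finset U} (hX : Function.Injective X) :
    (rootData F x b c).val Jᶜ (Finset.univ.image X) =
      ∑ j, (D.inDeg (freeArcs F) (X j) : ℤ) -
        ∑ j, ((missing F (J.biUnion block) (X j)).card : ℤ) +
        ∑ u ∈ Finset.univ.erase x \ Finset.univ.biUnion X,
          (weight F x (J.biUnion block)ᶜ u : ℤ) := by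
  unfold RootData.val RootData.spare
  rw [Finset.sum_image hX.injOn, Finset.sum_sub_distrib, Finset.image_biUnion]
  simp only [card_missing F x hb c, weight_eq_wt F x hb c]
  rfl

/-- As blocks are nonempty and disjoint, a block avoids the union over `J` exactly when its index is
not in `J`; an empty block would avoid every union. -/
theorem sum_demand (F : Fin k → D.Subdigraph) (x : U) {block : Fin l → Finset (Fin k)}
    (block_nonempty : ∀ α, (block α).Nonempty)
    {b : Fin k → Fin l} (hb : ∀ i α, i ∈ block α ↔ b i = α) (c : Fin l → ℕ) (J : Finset (Fin l)) :
    ∑ α with block α ⊆ (J.biUnion block)ᶜ,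
      ((c α : ℤ) - ∑ i ∈ block α, (D.outDeg (F i).arcs {x} : ℤ)) =
    ∑ α ∈ Jᶜ, (rootData F x b fun α => (c α : ℤ)).c α := by
  refine Finset.sum_congr ?_ fun α _ => ?_
  · ext α
    simp only [Finset.mem_filter, Finset.mem_univ, true_and, Finset.mem_compl]
    constructor
    · intro h hα
      obtain ⟨i, hi⟩ := block_nonempty α
      exact Finset.mem_compl.mp (h hi) (Finset.mem_biUnion.mpr ⟨α, hα, hi⟩)
    · intro hα i hi
      rw [Finset.mem_compl, Finset.mem_biUnion]
      rintro ⟨α', hα', hi'⟩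
      rw [hb] at hi hi'
      exact hα (hi ▸ hi' ▸ hα')
  · have : block α = Finset.univ.filter fun i => b i = α := by
      ext i
      simp [hb]
    rw [this]
    rfl

end MultiDigraph

theorem theorem1p5 {U A : Type*} [Fintype U] [DecidableEq U] [Fintype A] [DecidableEq A]
    (D : MultiDigraph U A) (x : U) (k l : ℕ) (hk : 0 < k)
    (block : Fin l → Finset (Fin k))
    (block_nonempty : ∀ α, (block α).Nonempty)
    (block_disjoint : ∀ α β, α ≠ β → Disjoint (block α) (block β))
    (block_cover : ∀ i, ∃ α, i ∈ block α)
    (c : Fin l → ℕ)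
    (F : Fin k → D.Subdigraph)
    (hF : ∀ i, (F i).IsArborescence x)
    (hFdisj : MultiDigraph.ArcDisjoint F) :
    (∃ F' : Fin k → D.Subdigraph,
        (∀ i, (F i).IsSub (F' i)) ∧
        (∀ i, (F' i).IsArborescence x ∧ (F' i).IsSpanning) ∧
        MultiDigraph.ArcDisjoint F' ∧
        ∀ α, c α ≤ ∑ i ∈ block α, D.outDeg (F' i).arcs {x}) ↔
      ∀ (t : ℕ) (X : Fin t → Finset U),
        (∀ j, (X j).Nonempty ∧ X j ⊆ Finset.univ.erase x) →
        (∀ i j, i ≠ j → Disjoint (X i) (X j)) →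
        ∀ (J : Finset (Fin l)) (I : Finset (Fin k)), I = J.biUnion block →
          (∑ j, (D.inDeg (MultiDigraph.freeArcs F) (X j) : ℤ)) ≥
            (∑ j, ((MultiDigraph.missing F I (X j)).card : ℤ)) +
            (∑ α with block α ⊆ Iᶜ,
              ((c α : ℤ) - ∑ i ∈ block α, (D.outDeg (F i).arcs {x} : ℤ))) -
            ∑ u ∈ Finset.univ.erase x \ Finset.univ.biUnion X,
              (MultiDigraph.weight F x Iᶜ u : ℤ) := by
  open MultiDigraph in
  choose b hbm using block_cover
  have hb : ∀ i α, i ∈ block α ↔ b i = α := by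
    refine fun i α => ⟨fun h => ?_, fun h => h ▸ hbm i⟩
    by_contra hne
    exact Finset.disjoint_left.mp (block_disjoint _ _ hne) (hbm i) h
  have hblock : ∀ α, block α = Finset.univ.filter fun i => b i = α := by
    intro α
    ext i
    simp [hb]
  have hT := fun i => (hF i).isOutTree
  constructor
  · rintro ⟨F', hsub, harb, hdis, hc⟩ t X hX hXd J I rfl
    have hfeas : (rootData F x b fun α => (c α : ℤ)).Feasible :=
      feasible_of_exists_spanning hT hsub (fun i => (harb i).1.isOutTree) (fun i => (harb i).2)
        hdis fun α => by
          have := hc α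
          rw [hblock] at this
          exact_mod_cast this
    -- Disjoint nonempty sets are distinct, so passing from the indexed family to its image loses no
    -- terms.
    have hinj : Function.Injective X := by
      intro i j hij
      by_contra hne
      have := hXd i j hne
      rw [hij, disjoint_self] at this
      exact (hX j).1.ne_empty this
    have h := hfeas Jᶜ (Finset.univ.image X) (by
      refine ⟨fun S hS => ?_, fun S hS S' hS' hne => ?_⟩
      · obtain ⟨j, -, rfl⟩ := Finset.mem_image.mp hS
        exact (hX j).1
      · obtain ⟨j, -, rfl⟩ := Finset.mem_image.mp hS
        obtain ⟨j', -, rfl⟩ := Finset.mem_image.mp hS'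
        exact hXd j j' fun e => hne (e ▸ rfl)) (by
      rw [Finset.image_biUnion]
      exact Finset.biUnion_subset.mpr fun j _ => (hX j).2)
    rw [val_image F x hb _ J hinj, ← sum_demand F x block_nonempty hb c J] at h
    linarith
  · intro h
    have hfeas : (rootData F x b fun α => (c α : ℤ)).Feasible := by
      intro K X hX hXV
      let e : Fin X.card → Finset U := fun j => (X.equivFin.symm j : Finset U)
      have hinj : Function.Injective e :=
        Subtype.val_injective.comp X.equivFin.symm.injective
      have hmem : ∀ j, e j ∈ X := fun j => (X.equivFin.symm j).2
      have himg : Finset.univ.image e = X := by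
        ext S
        simp only [Finset.mem_image, Finset.mem_univ, true_and]
        constructor
        · rintro ⟨j, rfl⟩
          exact hmem j
        · intro hS
          exact ⟨X.equivFin ⟨S, hS⟩, by simp [e]⟩
      have h' := h X.card e
        (fun j => ⟨hX.1 _ (hmem j), (Finset.subset_biUnion_of_mem id (hmem j)).trans hXV⟩)
        (fun i j hij => hX.2 _ (hmem i) _ (hmem j) fun he => hij (hinj he)) Kᶜ _ rfl
      have hval := val_image F x hb (fun α => (c α : ℤ)) Kᶜ hinj
      rw [sum_demand F x block_nonempty hb c Kᶜ] at h'
      rw [himg] at hval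
      rw [compl_compl] at h' hval
      linarith
    obtain ⟨F', h1, h2, h3, h4, h5⟩ := exists_spanning_of_feasible F hT hFdisj hfeas
    refine ⟨F', h1, fun i => ⟨(h2 i).isArborescence, h3 i⟩, h4, fun α => ?_⟩
    have := h5 α
    rw [← hblock] at this
    exact_mod_cast this
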